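/- **Setting.** Let $z_1,z_2,\dots$ be a stochastic process with values in a measurable space $\mathcal Z$, with law $P$ and regular conditional distributions $P_n=P(z_{n+1}\in\cdot\mid z_{1:n})$. Let $D$ be a convex subset of a real vector space, let $\ell(d,z)\in[0,1]$ ($d\in D$, $z\in\mathcal Z$) be a measurable loss that is convex in $d$, and let $\mathcal H\neq\emptyset$ be a class of measurable functions $h:\mathcal Z\to D$. Write $\ell(h,z)=\ell(h(z),z)$ and $\mathcal L(\mathcal H)=\{\ell(h,\cdot):h\in\mathcal H\}$. The conditional risk is $R_n(h)=\int \ell(h,z)\,P_n(dz)$. Assume that there are measurable functions $M_{i,j}$ of $z_{1:\max(i,j)-1}$ such that almost surely $$d_{i,j}:=\sup_{h\in\mathcal H}|R_{i-1}(h)-R_{j-1}(h)|\le M_{i,j}\qquad (i,j\ge 1),$$ and that the infima $\inf_{h\in\mathcal H}R_n(h)$ and $\inf_{h\in\mathcal H}\sum_{t\in C}\ell(h,z_t)$, $C$ finite, are measurable with respect to the completion of $P$. Let $\varepsilon_1\ge\varepsilon_2\ge\cdots$ be a sequence with $\varepsilon_t\to0$. **Algorithm (MACRO with thresholds $\varepsilon_t$).**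 Fix an online learning algorithm: for each $i \ge 0$, a (jointly measurable) map from the $i$ points it has been updated with to a hypothesis in $\mathcal H$. MACRO keeps a list of independent copies (subroutines) of it, initially empty; $\tau_j$ is the time at which subroutine $j$ is created. At time $t=1,2,\dots$, before $z_t$ is observed, let $J_t$ be the set of the existing $j$ with $M_{t,\tau_j}\le\varepsilon_t$; if there is none, create a new subroutine $j$ with $\tau_j=t$ and put $J_t=\{j\}$. The active subroutine is a minimizer of $M_{t,\tau_j}$ over $j\in J_t$ (ties broken in any measurable way). Then observe $z_t$ and update with it all subroutines in $J_t$. For $n\ge 0$, let $C_{j,n}=\{t\le n: j\in J_t\}=\{t_{j,1}<\dots<t_{j,s_{j,n}}\}$, let $h_{j,i}$ be the hypothesis of subroutine $j$ after $i$ updates, and let $I_n$ be the subroutine that is active at time $n+1$ (a function of $z_{1:n}$). After $n$ observations MACRO's output is $$h_n=\frac1{s_{I_n,n}}\sum_{i=1}^{s_{I_n,n}}h_{I_n,i}$$ (and $h_n=h_{I_n,0}$ if $s_{I_n,n}=0$). The regret of subroutine $j$ is $$W_{j,n}=\sum_{i=1}^{s_{j,n}}\ell(h_{j,i-1},z_{t_{j,i}})-\inf_{h\in\mathcal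 H}\sum_{i=1}^{s_{j,n}}\ell(h,z_{t_{j,i}}).$$ Let $\operatorname{supp}I_n=\{j:P(I_n=j)>0\}$ and $E_{k,m}=E_{k,m}^{(n)}=\{|\operatorname{supp}I_n|\le k\ \wedge\ \min_{j\in\operatorname{supp}I_n}s_{j,n}\ge m\}$. Let $\mathcal N_\infty(\mathcal F,\theta,n)$ be the sequential covering number: the supremum over all $\mathcal Z$-valued binary trees of depth $n$, $z=(z_t:\{\pm1\}^{t-1}\to\mathcal Z)_{t\le n}$, of the minimal size of a set $V$ of real-valued trees of depth $n$ such that for all $f\in\mathcal F$ and $\sigma\in\{\pm1\}^n$ some $v\in V$ satisfies $\max_{t\le n}|f(z_t(\sigma_{1:t-1}))-v_t(\sigma_{1:t-1})|\le\theta$. **Theorem.** (1) For all $n\ge 0$, $k,m\ge1$, $\alpha\in[0,1]$ and $\beta\in[0,\alpha/8]$, $$P\Big(R_n(h_n)-\inf_{h\in\mathcal H}R_n(h)>\alpha+\frac{W_{I_n,n}}{s_{I_n,n}}+\frac4{s_{I_n,n}}\sum_{t\in C_{I_n,n}}\varepsilon_t\Big)\le\frac{4k\,\mathcal N_\infty(\mathcal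 L(\mathcal H),\beta,n)}{(\alpha/2-4\beta)^2}\,e^{-\frac12m(\alpha/2-4\beta)^2}+P(E_{k,m}^c),$$ where the right-hand side is $+\infty$ if $\beta=\alpha/8$, and the two quotients on the left are read as $0$ if $s_{I_n,n}=0$ (which is impossible on $E_{k,m}$, up to a null set). (2) Suppose that the online algorithm is Hannan consistent, i.e. on every sequence of points the upper limit of its regret divided by the number of points is at most $0$. Let $\mathcal C$ be a class of processes that satisfy the assumptions above (with the same $M$) and for each of which there are sequences $k_n,m_n$ with $m_n/\log n\to\infty$ and $P\big((E^{(n)}_{k_n,m_n})^c\big)\to0$. Then this one algorithm, whose $n$-th output is based on $z_{1:n}$ only, satisfies $P(R_n(h_n)-\inf_{h\in\mathcal H}R_n(h)>\delta)\to0$ for every $\delta>0$ and every process in $\mathcal C$; and if $\mathcal H$ is convex, then $h_n\in\mathcal H$ and $R_n(h_n)-\inf_{h\in\mathcal H}R_n(h)\to0$ in probability for every process in $\mathcal C$, i.e. $\mathcal C$ is conditionally learnable in the limit. -/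

import Mathlib

open MeasureTheory ProbabilityTheory Filter Topology
open scoped ENNReal

noncomputable section

namespace CRM

/-! Time is indexed from `0`: the observations `z_1, z_2, …` are the coordinates `x 0, x 1, …` of a
path `x : ℕ → Z`, and step `t` of the procedure below, which has seen the `t` observations
`x 0, …, x (t - 1)` and is about to see `x t`, is the time point `t + 1` in one-based counting. -/

/-- The first `n` observations of a path. -/
def hist {Z : Type*} (n : ℕ) (x : ℕ → Z) : Fin n → Z := fun i => x i

/-- A discrete-time stochastic process with values in `Z`: its law on the space of paths, together
with a regular version `cond n` of the conditional distribution of the next observation given the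
first `n` observations. -/
structure StochProc (Z : Type*) [MeasurableSpace Z] where
  law : Measure (ℕ → Z)
  isProb : IsProbabilityMeasure law
  cond : (n : ℕ) → Kernel (Fin n → Z) Z
  isMarkov : ∀ n, IsMarkovKernel (cond n)
  isCond : ∀ n, law.map (fun x => (hist n x, x n)) = (law.map (hist n)) ⊗ₘ (cond n)

section Risk

variable {Z E : Type*} [MeasurableSpace Z]

/-- The conditional risk `R_n(h)`: the expected loss of `h` on the next observation, given the
first `n` observations. -/
def risk (P : StochProc Z) (loss : E → Z → ℝ) (h : Z → E) (n : ℕ) (x : ℕ → Z) : ℝ :=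
  ∫ z, loss (h z) z ∂(P.cond n (hist n x))

/-- The minimal conditional risk `inf_{h ∈ H} R_n(h)`. -/
def minRisk (P : StochProc Z) (loss : E → Z → ℝ) (H : Set (Z → E)) (n : ℕ) (x : ℕ → Z) : ℝ :=
  ⨅ h : H, risk P loss h n x

/-- The discrepancy `sup_{h ∈ H} |R_i(h) - R_j(h)|` between the conditional distributions of the
next observation after `i` and after `j` observations. -/
def discrepancy (P : StochProc Z) (loss : E → Z → ℝ) (H : Set (Z → E)) (i j : ℕ) (x : ℕ → Z) : ℝ :=
  ⨆ h : H, |risk P loss h i x - risk P loss h j x|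

/-- An algorithm, seen as the sequence of hypotheses it has produced after `n` observations, is an
`ε`-learner for the class `C` of processes: its `n`-th hypothesis is based on the first `n`
observations, and its excess conditional risk exceeds `ε` with vanishing probability. -/
def IsEpsLearner (loss : E → Z → ℝ) (H : Set (Z → E)) (alg : ℕ → (ℕ → Z) → Z → E)
    (C : Set (StochProc Z)) (ε : ℝ) : Prop :=
  (∀ n, DependsOn (alg n) (Set.Iio n)) ∧
  ∀ P ∈ C, Tendsto
    (fun n => P.law {x | risk P loss (alg n x) n x - minRisk P loss H n x > ε}) atTop (𝓝 0)

/-- A limit learner: its hypotheses belong to `H`, the `n`-th is based on the first `n`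
observations, and its excess conditional risk converges to zero in probability. -/
def IsLimitLearner (loss : E → Z → ℝ) (H : Set (Z → E)) (alg : ℕ → (ℕ → Z) → Z → E)
    (C : Set (StochProc Z)) : Prop :=
  (∀ n x, alg n x ∈ H) ∧ (∀ n, DependsOn (alg n) (Set.Iio n)) ∧
  ∀ P ∈ C, TendstoInMeasure P.law
    (fun n x => risk P loss (alg n x) n x - minRisk P loss H n x) atTop (fun _ => 0)

end Risk

section Covering

/-- A `Z`-valued tree of depth `n`: the `t`-th map takes the first `t` signs of a path. -/
abbrev Tree (n : ℕ) (Z : Type*) : Type _ := (t : Fin n) → (Fin t → Bool) → Z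

/-- The label at level `t` of a tree along a path of signs. -/
def Tree.label {n : ℕ} {Z : Type*} (z : Tree n Z) (σ : Fin n → Bool) (t : Fin n) : Z :=
  z t (fun i => σ (Fin.castLE t.isLt.le i))

/-- `V` is a sequential `θ`-cover, in the sup norm, of the function class `F` on the tree `z`. -/
def IsSeqCover {n : ℕ} {Z : Type*} (F : Set (Z → ℝ)) (θ : ℝ) (z : Tree n Z)
    (V : Set (Tree n ℝ)) : Prop :=
  ∀ f ∈ F, ∀ σ : Fin n → Bool, ∃ v ∈ V, ∀ t : Fin n, |f (z.label σ t) - v.label σ t| ≤ θ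

/-- The maximal sequential `θ`-covering number of `F` over the trees of depth `n`. -/
def seqCoveringNumber {Z : Type*} (F : Set (Z → ℝ)) (θ : ℝ) (n : ℕ) : ℕ∞ :=
  ⨆ z : Tree n Z, ⨅ V : {V : Set (Tree n ℝ) // IsSeqCover F θ z V}, (V : Set (Tree n ℝ)).encard

/-- The class of the functions `z ↦ ℓ(h(z), z)`, for `h ∈ H`. -/
def lossClass {Z E : Type*} (loss : E → Z → ℝ) (H : Set (Z → E)) : Set (Z → ℝ) :=
  (fun h z => loss (h z) z) '' H

end Covering

section Regret

variable {Z E : Type*}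

/-- An online learning algorithm: the hypothesis after `i` updates, as a function of the `i` points
it has been updated with. -/
abbrev OnlineAlg (Z E : Type*) := (i : ℕ) → (Fin i → Z) → Z → E

/-- The regret of an online algorithm over the first `s` points of the sequence `y`. -/
def regret (loss : E → Z → ℝ) (H : Set (Z → E)) (A : OnlineAlg Z E) (s : ℕ) (y : ℕ → Z) : ℝ :=
  ∑ i ∈ Finset.range s, loss (A i (hist i y) (y i)) (y i)
    - ⨅ h : H, ∑ i ∈ Finset.range s, loss ((h : Z → E) (y i)) (y i)

/-- Hannan consistency: on each sequence, the upper limit of the average regret is at most `0`. -/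
def HannanConsistent (loss : E → Z → ℝ) (H : Set (Z → E)) (A : OnlineAlg Z E) : Prop :=
  ∀ y : ℕ → Z, ∀ δ > 0, ∀ᶠ s : ℕ in atTop, regret loss H A s y / s ≤ δ

end Regret

section Macro

variable {Z E : Type*}

/-- Computable bounds: `M i j` is a function of the first `max i j` observations, that is, of those
on which the `i`-th and `j`-th conditional distributions depend. -/
abbrev Bounds (Z : Type*) := (i j : ℕ) → (Fin (max i j) → Z) → ℝ

variable (M : Bounds Z) (ε : ℕ → ℝ)

open scoped Classical in
/-- The indices, in a list `L` of starting times of subroutines, of the subroutines that are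
`ε_t`-close at step `t`. -/
def closeIn (x : ℕ → Z) (t : ℕ) (L : List ℕ) : Finset ℕ :=
  (Finset.range L.length).filter fun j => M t (L.getD j 0) (hist _ x) ≤ ε t

open scoped Classical in
/-- The starting times `τ_0, τ_1, …` of the subroutines created in the steps before step `t`. -/
def starts (x : ℕ → Z) : ℕ → List ℕ
  | 0 => []
  | t + 1 => if closeIn M ε x t (starts x t) = ∅ then starts x t ++ [t] else starts x t

open scoped Classical in
/-- The set `J` of step `t`: the `ε_t`-close subroutines or, if there are none, the one that is
created in this step. These subroutines are updated with `x t`. -/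
def closeSet (x : ℕ → Z) (t : ℕ) : Finset ℕ :=
  if closeIn M ε x t (starts M ε x t) = ∅ then {(starts M ε x t).length}
  else closeIn M ε x t (starts M ε x t)

/-- The starting time of subroutine `j`, as known in step `t` after the possible creation of a new
subroutine. -/
def startTime (x : ℕ → Z) (t j : ℕ) : ℕ := (starts M ε x (t + 1)).getD j 0

/-- `I n` is a choice, from the first `n` observations, of the active subroutine of step `n`: an
element of `J` that minimizes `M_{n, τ_j}`, ties being broken in any measurable way. -/
structure IsActiveRule [MeasurableSpace Z] (I : (n : ℕ) → (Fin n → Z) → ℕ) : Prop where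
  measurable : ∀ n, Measurable (I n)
  mem : ∀ n x, I n (hist n x) ∈ closeSet M ε x n
  le : ∀ n x, ∀ j ∈ closeSet M ε x n,
    M n (startTime M ε x n (I n (hist n x))) (hist _ x) ≤ M n (startTime M ε x n j) (hist _ x)

open scoped Classical in
/-- The set `C_{j,n}` of the steps, among the first `n`, in which subroutine `j` is updated. -/
def updates (j n : ℕ) (x : ℕ → Z) : Finset ℕ :=
  (Finset.range n).filter fun t => j ∈ closeSet M ε x t

/-- The number `s_{j,n}` of updates of subroutine `j` in the first `n` steps. -/
def numUpdates (j n : ℕ) (x : ℕ → Z) : ℕ := (updates M ε j n x).card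

/-- The sequence of the observations with which subroutine `j` is updated (its first `s_{j,n}` terms
are meaningful after `n` steps, and only those will be used). -/
def feed (j : ℕ) (x : ℕ → Z) : ℕ → Z := fun i => x (Nat.nth (fun t => j ∈ closeSet M ε x t) i)

/-- The hypothesis `h_{j,i}` of subroutine `j` after `i` updates. -/
def subHyp (A : OnlineAlg Z E) (j i : ℕ) (x : ℕ → Z) : Z → E := A i (hist i (feed M ε j x))

/-- The regret `W_{j,n}` of subroutine `j` after `n` steps. -/
def subRegret (loss : E → Z → ℝ) (H : Set (Z → E)) (A : OnlineAlg Z E) (j n : ℕ) (x : ℕ → Z) : ℝ :=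
  regret loss H A (numUpdates M ε j n x) (feed M ε j x)

/-- The hypothesis `h_n` that the meta-algorithm holds ready after `n` observations: the average of
`h_{I_n,1}, …, h_{I_n,s}` with `s = s_{I_n,n}`, and `h_{I_n,0}` if the active subroutine has only just
been created. -/
def output [AddCommGroup E] [Module ℝ E] (A : OnlineAlg Z E) (I : (n : ℕ) → (Fin n → Z) → ℕ)
    (n : ℕ) (x : ℕ → Z) : Z → E :=
  if numUpdates M ε (I n (hist n x)) n x = 0 then subHyp M ε A (I n (hist n x)) 0 x
  else (numUpdates M ε (I n (hist n x)) n x : ℝ)⁻¹ •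
    ∑ i ∈ Finset.range (numUpdates M ε (I n (hist n x)) n x),
      subHyp M ε A (I n (hist n x)) (i + 1) x

/-- The support of the distribution of `I_n`. -/
def activeSupport [MeasurableSpace Z] (P : StochProc Z) (I : (n : ℕ) → (Fin n → Z) → ℕ) (n : ℕ) :
    Set ℕ :=
  {j | 0 < P.law {x | I n (hist n x) = j}}

/-- The favourable realizations `E_{k,m}` (at step `n`); the exceptional set is the complement. -/
def favourable [MeasurableSpace Z] (P : StochProc Z) (I : (n : ℕ) → (Fin n → Z) → ℕ) (k m n : ℕ) :
    Set (ℕ → Z) :=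
  {x | (activeSupport P I n).encard ≤ k ∧ ∀ j ∈ activeSupport P I n, m ≤ numUpdates M ε j n x}

/-- The standing assumption on the process: almost surely, the discrepancies are bounded by `M`. The
two other fields say that the infima over `H` in the conditional risk and in the regret are random
variables (for the completed law). -/
structure Admissible [MeasurableSpace Z] (loss : E → Z → ℝ) (H : Set (Z → E)) (P : StochProc Z) :
    Prop where
  le_bound : ∀ i j, ∀ᵐ x ∂P.law, discrepancy P loss H i j x ≤ M i j (hist _ x)
  aemeasurable_minRisk : ∀ n, AEMeasurable (minRisk P loss H n) P.law
  aemeasurable_minLoss : ∀ C : Finset ℕ,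
    AEMeasurable (fun x : ℕ → Z => ⨅ h : H, ∑ t ∈ C, loss ((h : Z → E) (x t)) (x t)) P.law

end Macro

end CRM

end

/-! The mechanism is an online-to-batch conversion, one subroutine at a time. Fix a subroutine `j`
that is close at step `n`. At each of its update times, and at `n` itself, every conditional risk is
within the current threshold of the one at the starting time `τ` of `j`. A near-minimizer `h` of the
risk at `τ` is therefore nearly optimal at `n`, up to thresholds. Convexity bounds the risk of the
averaged output by the average risk of the hypotheses, and regret compares their losses with those
of `h`. What remains is a sum of martingale differences, each the conditionally centred value of a
loss difference in `[-1, 1]`. By `lt_sum_of_excess_risk`, a large excess risk forces this sum to be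
almost `α` times the number of updates; an Azuma–Hoeffding bound, `StochProc.measure_le_exp_neg`,
makes that exponentially unlikely. A union bound over the support of `I n` gives
`measure_excessEvent_le`.

Since `h` is fixed from the start of the subroutine, no uniform deviation over `H` has to be
controlled: the bound obtained is free of covering numbers, and `exp_bound_le` compares it with the
stated one using only that a covering number is at least `1`. The price is measurability. The
comparator is an arbitrary choice for each history, so the exponential supermartingale is handled by
lower integrals over histories, and the event is conditioned on the first `n` observations through
the trajectory kernel.

For learnability, a newly created subroutine is active at once and has no updates. If favourable
realizations have positive probability from `n₀` on, this rules out, almost surely, the creation of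
any subroutine with index at least `n₀` (`measure_active_eq_zero_of_le`). Only finitely many regrets
then matter, and Hannan consistency, which is not uniform over sequences, can be applied to each
separately. -/

namespace CRM

/-! ### Disintegration of the law along its conditional kernels. -/

section Trajectories

variable {Z : Type*} [MeasurableSpace Z]

lemma measurable_hist (n : ℕ) : Measurable (hist (Z := Z) n) :=
  measurable_pi_lambda _ fun i => measurable_pi_apply (i : ℕ)

/-- A history indexed by `Fin (n + 1)`, from one indexed by `Finset.Iic n`. -/
def iicToFin (n : ℕ) (y : (i : Finset.Iic n) → Z) : Fin (n + 1) → Z :=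
  fun i => y ⟨i, Finset.mem_Iic.2 (Nat.lt_succ_iff.1 i.2)⟩

/-- A history indexed by `Finset.Iic n`, from one indexed by `Fin (n + 1)`. -/
def finToIic (n : ℕ) (y : Fin (n + 1) → Z) : (i : Finset.Iic n) → Z :=
  fun i => y ⟨i, Nat.lt_succ_iff.2 (Finset.mem_Iic.1 i.2)⟩

lemma measurable_iicToFin (n : ℕ) : Measurable (iicToFin (Z := Z) n) :=
  measurable_pi_lambda _ fun _ => measurable_pi_apply _

lemma measurable_finToIic (n : ℕ) : Measurable (finToIic (Z := Z) n) :=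
  measurable_pi_lambda _ fun _ => measurable_pi_apply _

/-- The conditional distributions of a process, with histories indexed by `Finset.Iic n`. -/
noncomputable def StochProc.kernel (P : StochProc Z) (n : ℕ) :
    Kernel ((i : Finset.Iic n) → Z) Z :=
  (P.cond (n + 1)).comap (iicToFin n) (measurable_iicToFin n)

instance (P : StochProc Z) : IsProbabilityMeasure P.law := P.isProb

instance (P : StochProc Z) (n : ℕ) : IsMarkovKernel (P.cond n) := P.isMarkov n

instance (P : StochProc Z) (n : ℕ) : IsMarkovKernel (P.kernel n) := by
  unfold StochProc.kernel; infer_instance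

lemma StochProc.map_frestrictLe_compProd (P : StochProc Z) (n : ℕ) :
    (P.law.map (Preorder.frestrictLe (π := fun _ => Z) n)) ⊗ₘ P.kernel n =
      P.law.map (fun x => (Preorder.frestrictLe (π := fun _ => Z) n x, x (n + 1))) := by
  have : IsProbabilityMeasure (P.law.map (Preorder.frestrictLe (π := fun _ => Z) n)) :=
    Measure.isProbabilityMeasure_map (by fun_prop)
  have : IsProbabilityMeasure (P.law.map (hist (Z := Z) (n + 1))) :=
    Measure.isProbabilityMeasure_map (measurable_hist _).aemeasurable
  ext s hs
  have hT : Measurable (Prod.map (finToIic (Z := Z) n) (id : Z → Z)) :=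
    (measurable_finToIic n).prodMap measurable_id
  have h := congrArg (fun μ => μ (Prod.map (finToIic (Z := Z) n) id ⁻¹' s)) (P.isCond (n + 1))
  rw [Measure.map_apply ((measurable_hist _).prodMk (measurable_pi_apply _)) (hT hs),
    Measure.compProd_apply (hT hs),
    lintegral_map (Kernel.measurable_kernel_prodMk_left (hT hs)) (measurable_hist _)] at h
  rw [Measure.compProd_apply hs, lintegral_map (Kernel.measurable_kernel_prodMk_left hs)
    (by fun_prop), Measure.map_apply (by fun_prop) hs]
  exact h.symm

lemma StochProc.map_frestrictLe_succ (P : StochProc Z) (n : ℕ) :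
    P.law.map (Preorder.frestrictLe (π := fun _ => Z) (n + 1)) =
      Kernel.partialTraj (X := fun _ => Z) P.kernel n (n + 1) ∘ₘ
        P.law.map (Preorder.frestrictLe (π := fun _ => Z) n) := by
  have : IsProbabilityMeasure (P.law.map (Preorder.frestrictLe (π := fun _ => Z) n)) :=
    Measure.isProbabilityMeasure_map (by fun_prop)
  have hs : Measurable (MeasurableEquiv.piSingleton (X := fun _ : ℕ => Z) n) :=
    MeasurableEquiv.measurable _
  have hI : Measurable (IicProdIoc (X := fun _ : ℕ => Z) n (n + 1)) := measurable_IicProdIoc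
  rw [Kernel.partialTraj_succ_self]
  refine Eq.trans ?_ (Measure.map_comp _ (Kernel.id ×ₖ (P.kernel n).map
    (MeasurableEquiv.piSingleton (X := fun _ : ℕ => Z) n)) hI)
  rw [← Measure.compProd_eq_comp_prod, Measure.compProd_map hs, P.map_frestrictLe_compProd,
    Measure.map_map hI (by fun_prop),
    Measure.map_map (hI.comp (measurable_id.prodMap hs)) (by fun_prop)]
  congr 1
  ext x i
  by_cases hi : (i : ℕ) ≤ n
  · simp [IicProdIoc_def, hi]
  · have hi' : (i : ℕ) = n + 1 := by have := Finset.mem_Iic.1 i.2; lia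
    simp [IicProdIoc_def, MeasurableEquiv.piSingleton, hi']

/-- A law on paths is determined by its marginals from time `n` on, and these agree because each
arises from the preceding one by one step of the kernel. This yields a conditional law of the whole
path for an arbitrary measurable space `Z`. -/
lemma StochProc.traj_comp_map (P : StochProc Z) (n : ℕ) :
    Kernel.traj (X := fun _ => Z) P.kernel n ∘ₘ P.law.map (Preorder.frestrictLe (π := fun _ => Z) n)
      = P.law := by
  have hp (b : ℕ) (hb : n ≤ b) : P.law.map (Preorder.frestrictLe (π := fun _ => Z) b) =
      Kernel.partialTraj (X := fun _ => Z) P.kernel n b ∘ₘ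
        P.law.map (Preorder.frestrictLe (π := fun _ => Z) n) := by
    induction b, hb using Nat.le_induction with
    | base => simp
    | succ b hb ih =>
      rw [P.map_frestrictLe_succ, Kernel.partialTraj_succ_eq_comp hb, ih, Measure.comp_assoc]
  have hproj : IsProjectiveMeasureFamily (α := fun _ : ℕ => Z)
      (fun I : Finset ℕ => P.law.map (Finset.restrict (π := fun _ => Z) I)) := by
    intro I J hJI
    rw [Measure.map_map (Finset.measurable_restrict₂ (X := fun _ => Z) hJI)
      (Finset.measurable_restrict (X := fun _ => Z) I)]
    rfl
  have (I : Finset ℕ) : IsFiniteMeasure (P.law.map (Finset.restrict (π := fun _ => Z) I)) :=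
    inferInstance
  have hlaw : IsProjectiveLimit P.law
      (fun I : Finset ℕ => P.law.map (Finset.restrict (π := fun _ => Z) I)) := fun _ => rfl
  refine IsProjectiveLimit.unique ?_ hlaw
  rw [isProjectiveLimit_nat_iff' hproj _ n]
  intro b hb
  rw [Measure.map_comp _ _ (by fun_prop), Kernel.traj_map_frestrictLe, ← hp b hb]
  rfl

/-- An event is the integral of a measurable function of the first `n` observations that vanishes
at each history that has no extension in the event. -/
lemma StochProc.exists_lintegral_eq (P : StochProc Z) (n : ℕ) {B : Set (ℕ → Z)}
    (hB : MeasurableSet B) :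
    ∃ g : (Fin n → Z) → ℝ≥0∞, Measurable g ∧ ∫⁻ y, g y ∂(P.law.map (hist n)) = P.law B ∧
      ∀ y, g y ≤ 1 ∧ (g y ≠ 0 → ∃ x ∈ B, hist n x = y) := by
  cases n with
  | zero =>
    have : IsProbabilityMeasure (P.law.map (hist (Z := Z) 0)) :=
      Measure.isProbabilityMeasure_map (measurable_hist _).aemeasurable
    refine ⟨fun _ => P.law B, measurable_const, by simp, fun y => ⟨prob_le_one, fun h => ?_⟩⟩
    obtain ⟨x, hx⟩ := nonempty_of_measure_ne_zero h
    exact ⟨x, hx, Subsingleton.elim _ _⟩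
  | succ n =>
    let T := Kernel.traj (X := fun _ => Z) P.kernel n
    refine ⟨fun y => T (finToIic n y) B,
      (T.measurable_coe hB).comp (measurable_finToIic n), ?_, fun y => ⟨prob_le_one, fun h => ?_⟩⟩
    · have hm : Measurable fun y => T (finToIic n y) B :=
        (T.measurable_coe hB).comp (measurable_finToIic n)
      rw [lintegral_map hm (measurable_hist _)]
      conv_rhs => rw [← P.traj_comp_map n, Measure.bind_apply hB T.aemeasurable,
        lintegral_map (T.measurable_coe hB) (by fun_prop)]
      rfl
    · simp only [T] at h
      -- The trajectory kernel keeps its initial history, so overwriting a path with that history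
      -- leaves the law unchanged; positive mass then yields a path in `B` that really extends `y`.
      rw [← Kernel.traj_map_updateFinset, Measure.map_apply (by fun_prop) hB] at h
      obtain ⟨x, hx⟩ := nonempty_of_measure_ne_zero h
      refine ⟨_, hx, ?_⟩
      ext i
      have hi : (i : ℕ) ≤ n := Nat.lt_succ_iff.1 i.2
      simp [hist, Function.updateFinset, hi, finToIic]

end Trajectories

/-! ### Finite histories and their extensions to paths. -/

section Histories

variable {Z : Type*}

lemma hist_succ (n : ℕ) (x : ℕ → Z) :
    hist (n + 1) x = Fin.snoc (α := fun _ => Z) (hist n x) (x n) := by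
  ext i
  refine Fin.lastCases ?_ (fun i => ?_) i
  · simp [hist]
  · simp [hist]

/-- The path that continues a finite history by a constant. -/
def extend (z₀ : Z) {n : ℕ} (y : Fin n → Z) : ℕ → Z := fun i => if h : i < n then y ⟨i, h⟩ else z₀

lemma hist_extend (z₀ : Z) {n : ℕ} (y : Fin n → Z) : hist n (extend z₀ y) = y := by
  ext i; simp [hist, extend]

lemma extend_snoc_of_lt (z₀ : Z) {n : ℕ} (y : Fin n → Z) (z : Z) {i : ℕ} (hi : i < n) :
    extend z₀ (Fin.snoc (α := fun _ => Z) y z : Fin (n + 1) → Z) i = extend z₀ y i := by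
  simp [extend, hi, Nat.lt_succ_of_lt hi, Fin.snoc]

lemma extend_snoc_self (z₀ : Z) {n : ℕ} (y : Fin n → Z) (z : Z) :
    extend z₀ (Fin.snoc (α := fun _ => Z) y z : Fin (n + 1) → Z) n = z := by
  simp [extend, Fin.snoc]

lemma extend_hist_of_lt (z₀ : Z) {n : ℕ} (x : ℕ → Z) {i : ℕ} (hi : i < n) :
    extend z₀ (hist n x) i = x i := by
  simp [extend, hist, hi]

end Histories

/-! ### Azuma–Hoeffding without measurability in the past. -/

section Concentration

variable {Z : Type*} [MeasurableSpace Z]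

lemma measurable_snoc (n : ℕ) :
    Measurable fun p : (Fin n → Z) × Z => (Fin.snoc (α := fun _ => Z) p.1 p.2 : Fin (n + 1) → Z) := by
  refine measurable_pi_lambda _ fun i => ?_
  refine Fin.lastCases ?_ (fun i => ?_) i
  · simpa using measurable_snd
  · simpa [Function.comp_def] using (measurable_pi_apply i).comp measurable_fst

lemma StochProc.lintegral_hist_succ (P : StochProc Z) (n : ℕ) {g : (Fin (n + 1) → Z) → ℝ≥0∞}
    (hg : Measurable g) :
    ∫⁻ y, g y ∂(P.law.map (hist (n + 1))) =
      ∫⁻ y, ∫⁻ z, g (Fin.snoc (α := fun _ => Z) y z) ∂(P.cond n y) ∂(P.law.map (hist n)) := by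
  have : IsProbabilityMeasure (P.law.map (hist (Z := Z) n)) :=
    Measure.isProbabilityMeasure_map (measurable_hist _).aemeasurable
  have hgs : Measurable fun p : (Fin n → Z) × Z => g (Fin.snoc (α := fun _ => Z) p.1 p.2) :=
    hg.comp (measurable_snoc n)
  have h := Measure.lintegral_compProd (μ := P.law.map (hist n)) (κ := P.cond n) hgs
  rw [← h, ← P.isCond n, lintegral_map hgs ((measurable_hist n).prodMk (measurable_pi_apply n)),
    lintegral_map hg (measurable_hist _)]
  simp_rw [hist_succ]

/-- A supermartingale bound. The functions `V t` need not be measurable: their integrals are lower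
integrals. -/
lemma StochProc.lintegral_hist_le (P : StochProc Z) (V : (t : ℕ) → (Fin t → Z) → ℝ≥0∞)
    (hV : ∀ t y, ∫⁻ z, V (t + 1) (Fin.snoc (α := fun _ => Z) y z) ∂(P.cond t y) ≤ V t y)
    (n : ℕ) (g : (Fin n → Z) → ℝ≥0∞) (hg : Measurable g) (hgV : ∀ y, g y ≤ V n y) :
    ∫⁻ y, g y ∂(P.law.map (hist n)) ≤ V 0 Fin.elim0 := by
  induction n with
  | zero =>
    have : IsProbabilityMeasure (P.law.map (hist (Z := Z) 0)) :=
      Measure.isProbabilityMeasure_map (measurable_hist _).aemeasurable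
    calc ∫⁻ y, g y ∂(P.law.map (hist 0)) = ∫⁻ _, g Fin.elim0 ∂(P.law.map (hist 0)) :=
          lintegral_congr fun y => congrArg g (Subsingleton.elim _ _)
      _ ≤ V 0 Fin.elim0 := by simpa using hgV _
  | succ n ih =>
    have hgs : Measurable fun p : (Fin n → Z) × Z => g (Fin.snoc (α := fun _ => Z) p.1 p.2) :=
      hg.comp (measurable_snoc n)
    rw [P.lintegral_hist_succ n hg]
    -- Integrating out the last observation turns a measurable minorant of `V (n + 1)` into a
    -- measurable minorant of `V n`.
    exact ih _ hgs.lintegral_kernel_prod_right' fun y =>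
      (lintegral_mono fun z => hgV _).trans (hV n y)

/-- Hoeffding's lemma: the variance proxy is the squared half-length of `[-1, 1]`, that is `1`. -/
lemma lintegral_exp_sub_integral_le (μ : Measure Z) [IsProbabilityMeasure μ] {u : Z → ℝ}
    (hu : Measurable u) (hub : ∀ z, u z ∈ Set.Icc (-1 : ℝ) 1) (r : ℝ) :
    ∫⁻ z, ENNReal.ofReal (Real.exp (r * (u z - ∫ w, u w ∂μ) - r ^ 2 / 2)) ∂μ ≤ 1 := by
  have h := hasSubgaussianMGF_of_mem_Icc (μ := μ) hu.aemeasurable (.of_forall hub)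
  have hm := h.mgf_le r
  have hi := h.integrable_exp_mul r
  simp only [Real.exp_sub _ (r ^ 2 / 2)]
  rw [← ofReal_integral_eq_lintegral_ofReal (hi.div_const _)
    (.of_forall fun z => by positivity), integral_div]
  rw [← ENNReal.ofReal_one]
  refine ENNReal.ofReal_le_ofReal ?_
  rw [div_le_one (Real.exp_pos _)]
  refine hm.trans (Real.exp_le_exp.2 ?_)
  have : ((‖(1 : ℝ) - -1‖₊ / 2) ^ 2 : NNReal) = 1 := by
    rw [← NNReal.coe_inj]; push_cast; norm_num
  rw [this]; simp

open scoped Classical in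
/-- The increment, at step `t`, of the logarithm of an exponential supermartingale. -/
noncomputable def logIncrement (P : StochProc Z) (p : ℕ → (ℕ → Z) → Prop)
    (u : ℕ → (ℕ → Z) → Z → ℝ) (r : ℝ) (t : ℕ) (x : ℕ → Z) (z : Z) : ℝ :=
  if p t x then r * (u t x z - ∫ w, u t x w ∂(P.cond t (hist t x))) - r ^ 2 / 2 else 0

lemma logIncrement_congr {P : StochProc Z} {p : ℕ → (ℕ → Z) → Prop} {u : ℕ → (ℕ → Z) → Z → ℝ}
    (hp : ∀ t x x', (∀ i < t, x i = x' i) → (p t x ↔ p t x'))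
    (hu : ∀ t x x', (∀ i < t, x i = x' i) → p t x → u t x = u t x') (r : ℝ) {t : ℕ} {x x' : ℕ → Z}
    (h : ∀ i < t, x i = x' i) (z : Z) :
    logIncrement P p u r t x z = logIncrement P p u r t x' z := by
  have hh : hist t x = hist t x' := funext fun i => h i i.2
  unfold logIncrement
  by_cases hx : p t x
  · rw [if_pos hx, if_pos ((hp t x x' h).1 hx), hu t x x' h hx, hh]
  · rw [if_neg hx, if_neg (mt (hp t x x' h).2 hx)]

/-- An Azuma–Hoeffding bound in which the predictable functions need not be measurable in the past,
for null-measurable events. -/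
lemma StochProc.measure_le_exp_neg (P : StochProc Z) (p : ℕ → (ℕ → Z) → Prop)
    (u : ℕ → (ℕ → Z) → Z → ℝ) (hp : ∀ t x x', (∀ i < t, x i = x' i) → (p t x ↔ p t x'))
    (hu : ∀ t x x', (∀ i < t, x i = x' i) → p t x → u t x = u t x')
    (hum : ∀ t x, p t x → Measurable (u t x))
    (hub : ∀ t x, p t x → ∀ z, u t x z ∈ Set.Icc (-1 : ℝ) 1) (r L : ℝ) (n : ℕ) {B : Set (ℕ → Z)}
    (hB : NullMeasurableSet B P.law)
    (hBL : ∀ x ∈ B, L ≤ ∑ t ∈ Finset.range n, logIncrement P p u r t x (x t)) :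
    P.law B ≤ ENNReal.ofReal (Real.exp (-L)) := by
  obtain ⟨x₀⟩ : Nonempty (ℕ → Z) := nonempty_of_isProbabilityMeasure P.law
  -- `B` may depend on the whole path. The conditional probability `g` of a measurable version of
  -- it, given the history, is the measurable function to be compared with `V n`.
  obtain ⟨B', hB'B, hB', hae⟩ := hB.exists_measurable_subset_ae_eq
  obtain ⟨g, hg, hgB, hgy⟩ := P.exists_lintegral_eq n hB'
  let S (t : ℕ) (x : ℕ → Z) : ℝ := ∑ s ∈ Finset.range t, logIncrement P p u r s x (x s)
  have hS (t : ℕ) (x x' : ℕ → Z) (h : ∀ i < t, x i = x' i) : S t x = S t x' :=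
    Finset.sum_congr rfl fun s hs => by
      have hs := Finset.mem_range.1 hs
      rw [logIncrement_congr hp hu r (fun i hi => h i (hi.trans hs)), h s hs]
  -- The constant extension is harmless: by `hS`, `S t` reads only the first `t` coordinates.
  let V (t : ℕ) (y : Fin t → Z) : ℝ≥0∞ := ENNReal.ofReal (Real.exp (S t (extend (x₀ 0) y)))
  have hV (t : ℕ) (y : Fin t → Z) :
      ∫⁻ z, V (t + 1) (Fin.snoc (α := fun _ => Z) y z) ∂(P.cond t y) ≤ V t y := by
    have hstep (z : Z) : V (t + 1) (Fin.snoc (α := fun _ => Z) y z) = V t y *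
        ENNReal.ofReal (Real.exp (logIncrement P p u r t (extend (x₀ 0) y) z)) := by
      simp only [V]
      rw [← ENNReal.ofReal_mul (Real.exp_nonneg _), ← Real.exp_add]
      congr 2
      simp only [S, Finset.sum_range_succ]
      congr 1
      · exact hS t _ _ fun i hi => extend_snoc_of_lt _ y z hi
      · rw [extend_snoc_self]
        exact logIncrement_congr hp hu r (fun i hi => extend_snoc_of_lt _ y z hi) z
    simp_rw [hstep]
    rw [lintegral_const_mul' _ _ ENNReal.ofReal_ne_top]
    refine mul_le_of_le_one_right' ?_
    by_cases hpt : p t (extend (x₀ 0) y)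
    · simp only [logIncrement, if_pos hpt, hist_extend]
      exact lintegral_exp_sub_integral_le _ (hum _ _ hpt) (hub _ _ hpt) r
    · simp [logIncrement, if_neg hpt]
  have hmain := P.lintegral_hist_le V hV n (fun y => ENNReal.ofReal (Real.exp L) * g y)
    (hg.const_mul _) fun y => by
      by_cases hy : g y = 0
      · simp [hy]
      obtain ⟨x, hx, rfl⟩ := (hgy y).2 hy
      refine (mul_le_of_le_one_right' (hgy _).1).trans (ENNReal.ofReal_le_ofReal
        (Real.exp_le_exp.2 ((hBL x (hB'B hx)).trans_eq ?_)))
      exact hS n _ _ fun i hi => (extend_hist_of_lt _ x hi).symm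
  rw [lintegral_const_mul _ hg, hgB, measure_congr hae] at hmain
  have h0 : V 0 Fin.elim0 = 1 := by simp [V, S]
  rw [h0] at hmain
  rw [Real.exp_neg, ENNReal.ofReal_inv_of_pos (Real.exp_pos _), ENNReal.le_inv_iff_mul_le, mul_comm]
  exact hmain

end Concentration

/-! ### Counting and enumerating the update times. -/

section Counting

lemma exists_nth_of_lt_count (p : ℕ → Prop) [DecidablePred p] {n i : ℕ} (hi : i < Nat.count p n) :
    ∃ t < n, p t ∧ Nat.count p t = i ∧ Nat.nth p i = t := by
  induction n with
  | zero => simp at hi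
  | succ n ih =>
    by_cases h : i < Nat.count p n
    · obtain ⟨t, ht, h⟩ := ih h
      exact ⟨t, ht.trans n.lt_succ_self, h⟩
    · rw [Nat.count_succ] at hi
      split_ifs at hi with hp
      · obtain rfl : i = Nat.count p n := by lia
        exact ⟨n, n.lt_succ_self, hp, rfl, Nat.nth_count hp⟩
      · lia

lemma nth_eq_nth_of_lt_count {p q : ℕ → Prop} [DecidablePred p] [DecidablePred q] {n i : ℕ}
    (h : ∀ t < n, (p t ↔ q t)) (hi : i < Nat.count p n) : Nat.nth p i = Nat.nth q i := by
  obtain ⟨t, ht, hp, rfl, he⟩ := exists_nth_of_lt_count p hi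
  have hc : Nat.count p t = Nat.count q t := by
    rw [Nat.count_eq_card_filter_range, Nat.count_eq_card_filter_range]
    refine congrArg _ (Finset.filter_congr fun s hs => h s ((Finset.mem_range.1 hs).trans ht))
  rw [he, hc, Nat.nth_count ((h t ht).1 hp)]

/-- `Nat.count` inverts `Nat.nth`. This moves sums over update numbers, as in the regret, to sums
over time steps, where the martingale structure lives. -/
lemma sum_range_count_nth (p : ℕ → Prop) [DecidablePred p] (n : ℕ) (F : ℕ → ℕ → ℝ) :
    ∑ i ∈ Finset.range (Nat.count p n), F i (Nat.nth p i) =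
      ∑ t ∈ (Finset.range n).filter p, F (Nat.count p t) t := by
  induction n with
  | zero => simp
  | succ n ih =>
    rw [Nat.count_succ, Finset.range_add_one, Finset.filter_insert]
    split_ifs with hp
    · rw [Finset.sum_range_succ, ih, Nat.nth_count hp, Finset.sum_insert (by simp), add_comm]
    · simpa using ih

end Counting

/-! ### Bookkeeping of the meta-algorithm and its causality. -/

section Subroutines

variable {Z : Type*} (M : Bounds Z) (ε : ℕ → ℝ)

lemma starts_succ_eq (x : ℕ → Z) (t : ℕ) : starts M ε x (t + 1) = starts M ε x t ∨
    closeIn M ε x t (starts M ε x t) = ∅ ∧ starts M ε x (t + 1) = starts M ε x t ++ [t] := by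
  rw [starts]
  split_ifs with h
  · exact Or.inr ⟨h, rfl⟩
  · exact Or.inl rfl

lemma lt_of_mem_starts (x : ℕ → Z) (t : ℕ) : ∀ s ∈ starts M ε x t, s < t := by
  induction t with
  | zero => simp [starts]
  | succ t ih =>
    intro s hs
    obtain h | ⟨-, h⟩ := starts_succ_eq M ε x t <;> rw [h] at hs
    · exact (ih s hs).trans t.lt_succ_self
    · obtain hs | hs := List.mem_append.1 hs
      · exact (ih s hs).trans t.lt_succ_self
      · rw [List.mem_singleton.1 hs]; exact t.lt_succ_self

lemma starts_prefix (x : ℕ → Z) {t t' : ℕ} (h : t ≤ t') :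
    starts M ε x t <+: starts M ε x t' := by
  induction t', h using Nat.le_induction with
  | base => exact List.prefix_rfl
  | succ t' _ ih =>
    obtain h | ⟨-, h⟩ := starts_succ_eq M ε x t' <;> rw [h]
    · exact ih
    · exact ih.trans (List.prefix_append _ _)

lemma length_starts_le (x : ℕ → Z) (t : ℕ) : (starts M ε x t).length ≤ t := by
  induction t with
  | zero => simp [starts]
  | succ t ih =>
    obtain h | ⟨-, h⟩ := starts_succ_eq M ε x t <;> rw [h]
    · lia
    · simpa using ih

lemma getD_starts_le (x : ℕ → Z) (t j : ℕ) : (starts M ε x t).getD j 0 ≤ t := by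
  by_cases hj : j < (starts M ε x t).length
  · rw [List.getD_eq_getElem _ _ hj]
    exact (lt_of_mem_starts M ε x t _ (List.getElem_mem hj)).le
  · rw [List.getD_eq_default _ _ (by lia)]; exact Nat.zero_le _

/-- A close subroutine is either new or was created before. -/
lemma mem_closeSet_iff {x : ℕ → Z} {t j : ℕ} : j ∈ closeSet M ε x t ↔
    (closeIn M ε x t (starts M ε x t) = ∅ ∧ j = (starts M ε x t).length) ∨
      j ∈ closeIn M ε x t (starts M ε x t) := by
  unfold closeSet
  split_ifs with h
  · simp [h]
  · simp [h]

lemma lt_length_of_mem_closeIn {x : ℕ → Z} {t j : ℕ} {L : List ℕ} (h : j ∈ closeIn M ε x t L) :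
    j < L.length := by
  simp only [closeIn, Finset.mem_filter, Finset.mem_range] at h
  exact h.1

lemma le_of_mem_closeIn {x : ℕ → Z} {t j : ℕ} {L : List ℕ} (h : j ∈ closeIn M ε x t L) :
    M t (L.getD j 0) (hist _ x) ≤ ε t := by
  simp only [closeIn, Finset.mem_filter, Finset.mem_range] at h
  exact h.2

lemma lt_length_of_mem_closeSet {x : ℕ → Z} {t j : ℕ} (h : j ∈ closeSet M ε x t) :
    j < (starts M ε x (t + 1)).length := by
  obtain ⟨h0, rfl⟩ | h := (mem_closeSet_iff M ε).1 h
  · simp [starts, h0]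
  · exact (lt_length_of_mem_closeIn M ε h).trans_le (starts_prefix M ε x t.le_succ).length_le

lemma getD_starts_eq {x : ℕ → Z} {t t' j : ℕ} (h : t ≤ t') (hj : j < (starts M ε x t).length) :
    (starts M ε x t').getD j 0 = (starts M ε x t).getD j 0 := by
  obtain ⟨L, hL⟩ := starts_prefix M ε x h
  rw [← hL, List.getD_append _ _ _ _ hj]

lemma startTime_eq {x : ℕ → Z} {t t' j : ℕ} (h : t ≤ t') (hj : j ∈ closeSet M ε x t) :
    startTime M ε x t' j = startTime M ε x t j :=
  getD_starts_eq M ε (Nat.succ_le_succ h) (lt_length_of_mem_closeSet M ε hj)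

/-- The starting time of a close subroutine is the present or is close. -/
lemma startTime_eq_or_le {x : ℕ → Z} {t j : ℕ} (hj : j ∈ closeSet M ε x t) :
    startTime M ε x t j = t ∨ M t (startTime M ε x t j) (hist _ x) ≤ ε t := by
  obtain ⟨h0, rfl⟩ | h := (mem_closeSet_iff M ε).1 hj
  · left; simp [startTime, starts, h0]
  · right
    have := le_of_mem_closeIn M ε h
    rwa [← getD_starts_eq M ε t.le_succ (lt_length_of_mem_closeIn M ε h)] at this

lemma startTime_le {x : ℕ → Z} {t j : ℕ} (hj : j ∈ closeSet M ε x t) :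
    startTime M ε x t j ≤ t := by
  obtain ⟨h0, rfl⟩ | h := (mem_closeSet_iff M ε).1 hj
  · simp [startTime, starts, h0]
  · rw [startTime, getD_starts_eq M ε t.le_succ (lt_length_of_mem_closeIn M ε h)]
    exact getD_starts_le M ε x t j

section Causality

variable {x x' : ℕ → Z}

lemma hist_congr {n : ℕ} (h : ∀ i < n, x i = x' i) : hist n x = hist n x' :=
  funext fun i => h i i.2

/-- When no starting time exceeds `t`, each bound consulted reads `max t τ = t` observations only.
-/
lemma closeIn_congr {t : ℕ} (h : ∀ i < t, x i = x' i) {L : List ℕ} (hL : ∀ j, L.getD j 0 ≤ t) :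
    closeIn M ε x t L = closeIn M ε x' t L := by
  classical
  unfold closeIn
  refine Finset.filter_congr fun j _ => ?_
  rw [hist_congr fun i hi => h i (by rwa [max_eq_left (hL j)] at hi)]

lemma starts_succ_congr {t : ℕ} (h : ∀ i < t, x i = x' i)
    (ih : starts M ε x t = starts M ε x' t) :
    starts M ε x (t + 1) = starts M ε x' (t + 1) := by
  have hc : closeIn M ε x t (starts M ε x t) = closeIn M ε x' t (starts M ε x' t) := by
    rw [← ih]; exact closeIn_congr M ε h fun j => getD_starts_le M ε x t j
  rw [starts, starts]
  by_cases hE : closeIn M ε x' t (starts M ε x' t) = ∅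
  · rw [if_pos (hc.trans hE), if_pos hE, ih]
  · rw [if_neg (hc ▸ hE), if_neg hE, ih]

lemma starts_congr {t : ℕ} (h : ∀ i < t, x i = x' i) :
    starts M ε x t = starts M ε x' t := by
  induction t with
  | zero => rfl
  | succ t ih =>
    have h' : ∀ i < t, x i = x' i := fun i hi => h i (hi.trans t.lt_succ_self)
    exact starts_succ_congr M ε h' (ih h')

lemma closeSet_congr {t : ℕ} (h : ∀ i < t, x i = x' i) :
    closeSet M ε x t = closeSet M ε x' t := by
  unfold closeSet
  rw [← starts_congr M ε h, closeIn_congr M ε h fun j => getD_starts_le M ε x t j]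

lemma startTime_congr {t : ℕ} (h : ∀ i < t, x i = x' i) (j : ℕ) :
    startTime M ε x t j = startTime M ε x' t j := by
  unfold startTime
  rw [starts_succ_congr M ε h (starts_congr M ε h)]

lemma updates_congr {n : ℕ} (h : ∀ i < n, x i = x' i) (j : ℕ) :
    updates M ε j n x = updates M ε j n x' := by
  classical
  unfold updates
  refine Finset.filter_congr fun t ht => ?_
  rw [closeSet_congr M ε fun i hi => h i (hi.trans (Finset.mem_range.1 ht))]

lemma numUpdates_congr {n : ℕ} (h : ∀ i < n, x i = x' i) (j : ℕ) :
    numUpdates M ε j n x = numUpdates M ε j n x' := by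
  rw [numUpdates, numUpdates, updates_congr M ε h]

end Causality

lemma numUpdates_eq_count (j n : ℕ) (x : ℕ → Z) :
    numUpdates M ε j n x = Nat.count (fun t => j ∈ closeSet M ε x t) n := by
  classical
  rw [Nat.count_eq_card_filter_range]; unfold numUpdates updates; congr

lemma numUpdates_le (j n : ℕ) (x : ℕ → Z) : numUpdates M ε j n x ≤ n := by
  classical
  rw [numUpdates_eq_count]; exact Nat.count_le _

lemma mem_updates {j n t : ℕ} {x : ℕ → Z} :
    t ∈ updates M ε j n x ↔ t < n ∧ j ∈ closeSet M ε x t := by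
  simp [updates]

/-- The observations with which a subroutine is updated in the first `n` steps depend only on its
update times in these steps. -/
lemma feed_eq_nth_updates {j n i : ℕ} {x : ℕ → Z} (hi : i < numUpdates M ε j n x) :
    feed M ε j x i = x (Nat.nth (fun t => t ∈ updates M ε j n x) i) := by
  classical
  rw [numUpdates_eq_count] at hi
  unfold feed
  rw [nth_eq_nth_of_lt_count (q := fun t => t ∈ updates M ε j n x) (fun t ht => ?_) hi]
  simp [mem_updates, ht]

lemma feed_congr {j n i : ℕ} {x x' : ℕ → Z} (h : ∀ i < n, x i = x' i)
    (hi : i < numUpdates M ε j n x) : feed M ε j x i = feed M ε j x' i := by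
  classical
  have hi' := hi
  rw [numUpdates_eq_count] at hi'
  obtain ⟨t, ht, hp, -, he⟩ := exists_nth_of_lt_count _ hi'
  have hi2 : i < numUpdates M ε j n x' := by rwa [← numUpdates_congr M ε h]
  have hne : Nat.nth (fun t => j ∈ closeSet M ε x' t) i = t := by
    rw [← he]
    exact (nth_eq_nth_of_lt_count (fun s hs => by
      rw [closeSet_congr M ε fun i hi => h i (hi.trans hs)]) hi').symm
  simp only [feed, he, hne, h t ht]

lemma sum_range_feed (j n : ℕ) (x : ℕ → Z) (F : ℕ → Z → ℝ) :
    ∑ i ∈ Finset.range (numUpdates M ε j n x), F i (feed M ε j x i) =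
      ∑ t ∈ updates M ε j n x, F (numUpdates M ε j t x) (x t) := by
  classical
  simp only [numUpdates_eq_count]
  convert! sum_range_count_nth (fun t => j ∈ closeSet M ε x t) n fun i t => F i (x t) using 2

lemma subHyp_congr {E : Type*} (A : OnlineAlg Z E) {j n i : ℕ} {x x' : ℕ → Z}
    (h : ∀ i < n, x i = x' i) (hi : i ≤ numUpdates M ε j n x) :
    subHyp M ε A j i x = subHyp M ε A j i x' := by
  unfold subHyp
  rw [hist_congr fun k hk => feed_congr M ε h (lt_of_lt_of_le hk hi)]

end Subroutines

/-! ### Convexity and the deterministic excess-risk inequality. -/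

section Averages

variable {Z E : Type*} [AddCommGroup E] [Module ℝ E]

lemma smul_sum_apply_eq_sum_smul (s : ℕ) (f : ℕ → Z → E) (z : Z) :
    ((s : ℝ)⁻¹ • ∑ i ∈ Finset.range s, f i) z = ∑ i ∈ Finset.range s, (s : ℝ)⁻¹ • f i z := by
  rw [Pi.smul_apply, Finset.sum_apply, Finset.smul_sum]

lemma sum_range_inv {s : ℕ} (hs : s ≠ 0) : ∑ _i ∈ Finset.range s, (s : ℝ)⁻¹ = 1 := by
  simp [hs]

end Averages

section BoundedLoss

variable {Z E : Type*} [MeasurableSpace Z] [AddCommGroup E] [Module ℝ E] [MeasurableSpace E]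

/-- A measurable convex loss on `D` with values in `[0, 1]`, and a nonempty class of measurable
functions with values in `D`. -/
structure IsBoundedConvexLoss (D : Set E) (loss : E → Z → ℝ) (H : Set (Z → E)) : Prop where
  measurable_loss : Measurable fun p : D × Z => loss p.1 p.2
  loss_mem : ∀ d ∈ D, ∀ z, loss d z ∈ Set.Icc (0 : ℝ) 1
  convexOn : ∀ z, ConvexOn ℝ D fun d => loss d z
  nonempty : H.Nonempty
  mem : ∀ h ∈ H, ∀ z, h z ∈ D
  measurable : ∀ h ∈ H, Measurable h

namespace IsBoundedConvexLoss

variable {D : Set E} {loss : E → Z → ℝ} {H : Set (Z → E)} (hl : IsBoundedConvexLoss D loss H)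
include hl

lemma measurable_comp {X : Type*} [MeasurableSpace X] {e : X → E} {f : X → Z} (he : Measurable e)
    (hf : Measurable f) (heD : ∀ x, e x ∈ D) : Measurable fun x => loss (e x) (f x) :=
  hl.measurable_loss.comp ((he.subtype_mk (h := heD)).prodMk hf)

lemma measurable_of_mem {h : Z → E} (hh : h ∈ H) : Measurable fun z => loss (h z) z :=
  hl.measurable_comp (hl.measurable h hh) measurable_id (hl.mem h hh)

lemma mem_Icc {h : Z → E} (hh : h ∈ H) (z : Z) : loss (h z) z ∈ Set.Icc (0 : ℝ) 1 :=
  hl.loss_mem _ (hl.mem h hh z) z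

lemma integrable {h : Z → E} (hh : h ∈ H) (μ : Measure Z) [IsProbabilityMeasure μ] :
    Integrable (fun z => loss (h z) z) μ :=
  Integrable.of_mem_Icc 0 1 (hl.measurable_of_mem hh).aemeasurable (.of_forall (hl.mem_Icc hh))

lemma risk_mem_Icc (P : StochProc Z) {h : Z → E} (hh : h ∈ H) (n : ℕ) (x : ℕ → Z) :
    risk P loss h n x ∈ Set.Icc (0 : ℝ) 1 := by
  refine ⟨integral_nonneg fun z => (hl.mem_Icc hh z).1, ?_⟩
  calc risk P loss h n x ≤ ∫ _, (1 : ℝ) ∂(P.cond n (hist n x)) :=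
        integral_mono (hl.integrable hh _) (integrable_const _) fun z => (hl.mem_Icc hh z).2
    _ = 1 := by simp

lemma bddBelow_risk (P : StochProc Z) (n : ℕ) (x : ℕ → Z) :
    BddBelow (Set.range fun h : H => risk P loss h n x) :=
  ⟨0, by rintro _ ⟨h, rfl⟩; exact (hl.risk_mem_Icc P h.2 n x).1⟩

lemma abs_risk_sub_le (P : StochProc Z) {h : Z → E} (hh : h ∈ H) (i j : ℕ) (x : ℕ → Z) :
    |risk P loss h i x - risk P loss h j x| ≤ discrepancy P loss H i j x := by
  refine le_ciSup (f := fun h : H => |risk P loss h i x - risk P loss h j x|) ⟨1, ?_⟩ ⟨h, hh⟩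
  rintro _ ⟨h, rfl⟩
  have h1 := hl.risk_mem_Icc P h.2 i x
  have h2 := hl.risk_mem_Icc P h.2 j x
  exact abs_le.2 ⟨by linarith [h1.1, h2.2], by linarith [h1.2, h2.1]⟩

lemma bddBelow_sum (C : Finset ℕ) (x : ℕ → Z) :
    BddBelow (Set.range fun h : H => ∑ t ∈ C, loss ((h : Z → E) (x t)) (x t)) :=
  ⟨0, by rintro _ ⟨h, rfl⟩; exact Finset.sum_nonneg fun t _ => (hl.mem_Icc h.2 _).1⟩

/-- Nearly minimal conditional risk is attained in the class, for each history. -/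
lemma exists_near_minimizer (P : StochProc Z) {η : ℝ} (hη : 0 < η) (n : ℕ) (y : Fin n → Z) :
    ∃ h ∈ H, ∀ x : ℕ → Z, hist n x = y → risk P loss h n x ≤ minRisk P loss H n x + η := by
  have : Nonempty H := hl.nonempty.to_subtype
  obtain ⟨h, hh⟩ := exists_lt_of_ciInf_lt
    (lt_add_of_pos_right (⨅ h : H, ∫ z, loss ((h : Z → E) z) z ∂(P.cond n y)) hη)
  refine ⟨h, h.2, ?_⟩
  rintro x rfl
  exact hh.le

lemma convex (z : Z) : Convex ℝ D := (hl.convexOn z).1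

variable {M : Bounds Z} {ε : ℕ → ℝ} {A : OnlineAlg Z E}

lemma loss_average_le {s : ℕ} (hs : s ≠ 0) {f : ℕ → Z → E} (hf : ∀ i, f i ∈ H) (z : Z) :
    loss (((s : ℝ)⁻¹ • ∑ i ∈ Finset.range s, f i) z) z ≤
      (s : ℝ)⁻¹ * ∑ i ∈ Finset.range s, loss (f i z) z := by
  rw [smul_sum_apply_eq_sum_smul, Finset.mul_sum]
  exact (hl.convexOn z).map_sum_le (fun _ _ => by positivity) (sum_range_inv hs)
    fun i _ => hl.mem _ (hf i) z

lemma average_mem {s : ℕ} (hs : s ≠ 0) {f : ℕ → Z → E} (hf : ∀ i, f i ∈ H) (z : Z) :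
    ((s : ℝ)⁻¹ • ∑ i ∈ Finset.range s, f i) z ∈ D := by
  rw [smul_sum_apply_eq_sum_smul]
  exact (hl.convex z).sum_mem (fun _ _ => by positivity) (sum_range_inv hs)
    fun i _ => hl.mem _ (hf i) z

lemma risk_average_le (P : StochProc Z) {s : ℕ} (hs : s ≠ 0) {f : ℕ → Z → E} (hf : ∀ i, f i ∈ H)
    (n : ℕ) (x : ℕ → Z) :
    risk P loss ((s : ℝ)⁻¹ • ∑ i ∈ Finset.range s, f i) n x ≤
      (s : ℝ)⁻¹ * ∑ i ∈ Finset.range s, risk P loss (f i) n x := by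
  unfold risk
  rw [← integral_finsetSum _ fun i _ => hl.integrable (hf i) _, ← integral_const_mul]
  refine integral_mono_of_nonneg
    (.of_forall fun z => (hl.loss_mem _ (hl.average_mem hs hf z) z).1)
    ((integrable_finsetSum _ fun i _ => hl.integrable (hf i) _).const_mul _)
    (.of_forall fun z => hl.loss_average_le hs hf z)

/-- The output averages the hypotheses after updates `1, …, s`, while regret concerns those numbered
`0, …, s - 1`. The two sums differ only in their end terms, at a cost of at most `1`. -/
lemma sum_risk_succ_le (P : StochProc Z) (s : ℕ) {f : ℕ → Z → E} (hf : ∀ i, f i ∈ H)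
    (n : ℕ) (x : ℕ → Z) :
    ∑ i ∈ Finset.range s, risk P loss (f (i + 1)) n x ≤
      1 + ∑ i ∈ Finset.range s, risk P loss (f i) n x := by
  have h := Finset.sum_range_succ' (fun i => risk P loss (f i) n x) s
  rw [Finset.sum_range_succ] at h
  linarith [(hl.risk_mem_Icc P (hf s) n x).2, (hl.risk_mem_Icc P (hf 0) n x).1]

/-- On a path on which the bounds `M` hold, the conditional risks at the update times of a
subroutine are close to the one at its starting time. -/
lemma abs_risk_sub_startTime_le (P : StochProc Z) (hε : ∀ t, 0 ≤ ε t) {x : ℕ → Z}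
    (hx : ∀ i j, discrepancy P loss H i j x ≤ M i j (hist _ x)) {t j : ℕ}
    (ht : j ∈ closeSet M ε x t) {h : Z → E} (hh : h ∈ H) :
    |risk P loss h t x - risk P loss h (startTime M ε x t j) x| ≤ ε t := by
  obtain he | he := startTime_eq_or_le M ε ht
  · rw [he]; simpa using hε t
  · exact (hl.abs_risk_sub_le P hh _ _ x).trans ((hx _ _).trans he)

/-- A large excess risk of the averaged hypothesis forces a large martingale sum. -/
lemma lt_sum_of_excess_risk (P : StochProc Z) (hA : ∀ i y, A i y ∈ H) (hε : Antitone ε)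
    (hε0 : ∀ t, 0 ≤ ε t) {x : ℕ → Z}
    (hx : ∀ i j, discrepancy P loss H i j x ≤ M i j (hist _ x)) {n j : ℕ}
    (hj : j ∈ closeSet M ε x n) (hs : 0 < numUpdates M ε j n x) {h : Z → E} (hh : h ∈ H) {η : ℝ}
    (hη : risk P loss h (startTime M ε x n j) x ≤ minRisk P loss H (startTime M ε x n j) x + η)
    {α : ℝ}
    (hbad : risk P loss ((numUpdates M ε j n x : ℝ)⁻¹ •
        ∑ i ∈ Finset.range (numUpdates M ε j n x), subHyp M ε A j (i + 1) x) n x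
          - minRisk P loss H n x >
        α + subRegret M ε loss H A j n x / numUpdates M ε j n x
          + 4 / numUpdates M ε j n x * ∑ t ∈ updates M ε j n x, ε t) :
    α * numUpdates M ε j n x - 1 - numUpdates M ε j n x * η <
      ∑ t ∈ updates M ε j n x,
        ((loss (h (x t)) (x t) - loss (subHyp M ε A j (numUpdates M ε j t x) x (x t)) (x t)) -
          (risk P loss h t x - risk P loss (subHyp M ε A j (numUpdates M ε j t x) x) t x)) := by
  have : Nonempty H := hl.nonempty.to_subtype
  set s := numUpdates M ε j n x with hs_def
  set C := updates M ε j n x with hC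
  set τ := startTime M ε x n j with hτ
  have hsR : (0 : ℝ) < s := by exact_mod_cast hs
  have hcard : (C.card : ℝ) = s := rfl
  have hyp_mem (i : ℕ) : subHyp M ε A j i x ∈ H := hA _ _
  have hC_risk (t : ℕ) (ht : t ∈ C) (g : Z → E) (hg : g ∈ H) :
      |risk P loss g t x - risk P loss g τ x| ≤ ε t := by
    obtain ⟨htn, ht⟩ := (mem_updates M ε).1 ht
    rw [hτ, startTime_eq M ε htn.le ht]
    exact hl.abs_risk_sub_startTime_le P hε0 hx ht hg
  have hn_risk (g : Z → E) (hg : g ∈ H) : |risk P loss g n x - risk P loss g τ x| ≤ ε n :=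
    hl.abs_risk_sub_startTime_le P hε0 hx hj hg
  have hεn (t : ℕ) (ht : t ∈ C) : ε n ≤ ε t := hε ((mem_updates M ε).1 ht).1.le
  have hout := hl.risk_average_le P hs.ne' (f := fun i => subHyp M ε A j (i + 1) x)
    (fun i => hyp_mem _) n x
  have hshift := hl.sum_risk_succ_le P s (f := fun i => subHyp M ε A j i x) hyp_mem n x
  have hsum : ∑ i ∈ Finset.range s, risk P loss (subHyp M ε A j i x) n x =
      ∑ t ∈ C, risk P loss (subHyp M ε A j (numUpdates M ε j t x) x) n x :=
    sum_range_feed M ε j n x fun i _ => risk P loss (subHyp M ε A j i x) n x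
  -- Passing from `n` to `t` via `τ` costs `ε n + ε t ≤ 2 * ε t`, as thresholds decrease. The same
  -- cost for the comparator in `hmin_sum` accounts for the constant `4`.
  have hle : ∑ t ∈ C, risk P loss (subHyp M ε A j (numUpdates M ε j t x) x) n x ≤
      ∑ t ∈ C, (risk P loss (subHyp M ε A j (numUpdates M ε j t x) x) t x + 2 * ε t) := by
    refine Finset.sum_le_sum fun t ht => ?_
    have h1 := abs_le.1 (hC_risk t ht _ (hyp_mem (numUpdates M ε j t x)))
    have h2 := abs_le.1 (hn_risk _ (hyp_mem (numUpdates M ε j t x)))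
    linarith [hεn t ht, h1.1, h2.2]
  -- `h` is `η`-optimal at `τ`, and no risk changes by more than `ε n` between `τ` and `n`.
  have hmin : risk P loss h τ x - η - ε n ≤ minRisk P loss H n x := by
    refine le_ciInf fun g => ?_
    have h1 := abs_le.1 (hn_risk g g.2)
    have h2 : minRisk P loss H τ x ≤ risk P loss g τ x := ciInf_le (hl.bddBelow_risk P τ x) g
    linarith [h1.1]
  have hmin_sum : ∑ t ∈ C, (risk P loss h t x - 2 * ε t) ≤ s * (minRisk P loss H n x + η) := by
    rw [← hcard, ← nsmul_eq_mul, ← Finset.sum_const]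
    refine Finset.sum_le_sum fun t ht => ?_
    have h1 := abs_le.1 (hC_risk t ht _ hh)
    linarith [hεn t ht, h1.2]
  have hreg : subRegret M ε loss H A j n x =
      ∑ t ∈ C, loss (subHyp M ε A j (numUpdates M ε j t x) x (x t)) (x t) -
        ⨅ g : H, ∑ t ∈ C, loss ((g : Z → E) (x t)) (x t) := by
    unfold subRegret regret
    congr 1
    · exact sum_range_feed M ε j n x fun i z => loss (subHyp M ε A j i x z) z
    · exact iInf_congr fun g => sum_range_feed M ε j n x fun _ z => loss ((g : Z → E) z) z
  have hinf : ⨅ g : H, ∑ t ∈ C, loss ((g : Z → E) (x t)) (x t) ≤ ∑ t ∈ C, loss (h (x t)) (x t) :=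
    ciInf_le (hl.bddBelow_sum C x) ⟨h, hh⟩
  have hbad' := mul_lt_mul_of_pos_left hbad hsR
  have e1 : (s : ℝ) * (α + subRegret M ε loss H A j n x / s + 4 / s * ∑ t ∈ C, ε t) =
      α * s + subRegret M ε loss H A j n x + 4 * ∑ t ∈ C, ε t := by
    field_simp
  have hout' := mul_le_mul_of_nonneg_left hout hsR.le
  rw [← mul_assoc, mul_inv_cancel₀ hsR.ne', one_mul] at hout'
  rw [e1, hreg] at hbad'
  simp only [Finset.sum_sub_distrib, Finset.sum_add_distrib, ← Finset.mul_sum] at *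
  linarith

end IsBoundedConvexLoss

end BoundedLoss

section Output

variable {Z E : Type*} [AddCommGroup E] [Module ℝ E]

lemma output_of_pos {M : Bounds Z} {ε : ℕ → ℝ} {A : OnlineAlg Z E}
    {I : (n : ℕ) → (Fin n → Z) → ℕ} {n : ℕ} {x : ℕ → Z}
    (hs : 0 < numUpdates M ε (I n (hist n x)) n x) :
    output M ε A I n x = (numUpdates M ε (I n (hist n x)) n x : ℝ)⁻¹ •
      ∑ i ∈ Finset.range (numUpdates M ε (I n (hist n x)) n x),
        subHyp M ε A (I n (hist n x)) (i + 1) x :=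
  if_neg hs.ne'

end Output

/-! ### Probability of a large excess risk for one subroutine. -/

section SubroutineBound

variable {Z E : Type*} [MeasurableSpace Z] [AddCommGroup E] [Module ℝ E] [MeasurableSpace E]

/-- The event that the excess conditional risk of the output is larger than in the risk bound. -/
def excessEvent (loss : E → Z → ℝ) (H : Set (Z → E)) (A : OnlineAlg Z E) (M : Bounds Z)
    (ε : ℕ → ℝ) (I : (n : ℕ) → (Fin n → Z) → ℕ) (P : StochProc Z) (α : ℝ) (n : ℕ) :
    Set (ℕ → Z) :=
  {x | risk P loss (output M ε A I n x) n x - minRisk P loss H n x >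
    α + subRegret M ε loss H A (I n (hist n x)) n x / numUpdates M ε (I n (hist n x)) n x
      + 4 / numUpdates M ε (I n (hist n x)) n x
        * ∑ t ∈ updates M ε (I n (hist n x)) n x, ε t}

/-- The contribution of one subroutine to the risk bound. The comparison hypothesis is a near-minimizer
of the conditional risk at the starting time of the subroutine, so that it is fixed by the past of all
its updates; it need not depend measurably on this past. -/
lemma IsBoundedConvexLoss.measure_excessEvent_inter_le {D : Set E} {loss : E → Z → ℝ}
    {H : Set (Z → E)} (hl : IsBoundedConvexLoss D loss H) {A : OnlineAlg Z E}
    (hA : ∀ i y, A i y ∈ H) {M : Bounds Z} {ε : ℕ → ℝ} (hε : Antitone ε) (hε0 : ∀ t, 0 ≤ ε t)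
    {I : (n : ℕ) → (Fin n → Z) → ℕ} (hI : IsActiveRule M ε I) {P : StochProc Z}
    (hP : Admissible M loss H P) {α : ℝ} (hα : α ∈ Set.Icc (0 : ℝ) 1) {n m j : ℕ} (hm : 1 ≤ m)
    {B : Set (ℕ → Z)} (hB : NullMeasurableSet B P.law)
    (hBs : B ⊆ excessEvent loss H A M ε I P α n ∩
      {x | I n (hist n x) = j ∧ m ≤ numUpdates M ε j n x}) :
    P.law B ≤ ENNReal.ofReal (Real.exp (-(m * α ^ 2 / 2 - 2))) := by
  -- There are at most `n` updates, so the slack `η` contributes at most `1` in total.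
  have hη : (0 : ℝ) < 1 / (n + 1) := by positivity
  choose sel hsel hsel_le using hl.exists_near_minimizer P hη
  have hgood : ∀ᵐ x ∂P.law, ∀ i j, discrepancy P loss H i j x ≤ M i j (hist _ x) :=
    ae_all_iff.2 fun i => ae_all_iff.2 fun j => hP.le_bound i j
  set G : Set (ℕ → Z) := {x | ∀ i j, discrepancy P loss H i j x ≤ M i j (hist _ x)} with hG
  have hBG : (B ∩ G : Set (ℕ → Z)) =ᵐ[P.law] B := by
    filter_upwards [hgood] with x hx
    exact propext ⟨fun h => h.1, fun h => ⟨h, hx⟩⟩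
  rw [← measure_congr hBG]
  -- Reading the starting time at step `t` makes the comparator predictable; at update times it is
  -- the same as when read at `n`, by `startTime_eq`.
  let cmp (t : ℕ) (x : ℕ → Z) : Z → E := sel (startTime M ε x t j) (hist _ x)
  let hyp (t : ℕ) (x : ℕ → Z) : Z → E := subHyp M ε A j (numUpdates M ε j t x) x
  have hcmp (t : ℕ) (x : ℕ → Z) : cmp t x ∈ H := hsel _ _
  have hhyp (t : ℕ) (x : ℕ → Z) : hyp t x ∈ H := hA _ _
  have hint (t : ℕ) (x : ℕ → Z) :
      ∫ w, (loss (cmp t x w) w - loss (hyp t x w) w) ∂(P.cond t (hist t x)) =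
        risk P loss (cmp t x) t x - risk P loss (hyp t x) t x :=
    integral_sub (hl.integrable (hcmp t x) _) (hl.integrable (hhyp t x) _)
  -- The parameter `r = α` maximizes `r * (α * s) - s * r ^ 2 / 2`. The errors `1` from the index
  -- shift and `s * η ≤ 1` cost at most `2` in the exponent, since `α ≤ 1`.
  refine P.measure_le_exp_neg (fun t x => j ∈ closeSet M ε x t)
    (fun t x z => loss (cmp t x z) z - loss (hyp t x z) z) ?_ ?_ ?_ ?_ α _ n
    (hB.congr hBG.symm) ?_
  · intro t x x' h
    rw [closeSet_congr M ε h]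
  · intro t x x' h hj
    have h1 : cmp t x = cmp t x' := by
      have hτ := startTime_le M ε hj
      simp only [cmp]
      rw [← startTime_congr M ε h j, hist_congr fun i hi => h i (hi.trans_le hτ)]
    have h2 : hyp t x = hyp t x' := by
      simp only [hyp]
      rw [← numUpdates_congr M ε h j, subHyp_congr M ε A h le_rfl]
    rw [h1, h2]
  · exact fun t x _ => (hl.measurable_of_mem (hcmp t x)).sub (hl.measurable_of_mem (hhyp t x))
  · intro t x _ z
    have h1 := hl.mem_Icc (hcmp t x) z
    have h2 := hl.mem_Icc (hhyp t x) z
    exact ⟨by linarith [h1.1, h2.2], by linarith [h1.2, h2.1]⟩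
  · rintro x ⟨hxB, hxG⟩
    obtain ⟨hbad, hIj, hms⟩ := hBs hxB
    have hpos : 0 < numUpdates M ε j n x := hm.trans hms
    have hj : j ∈ closeSet M ε x n := hIj ▸ hI.mem n x
    rw [excessEvent, Set.mem_ofPred_eq, output_of_pos (by rwa [hIj]), hIj] at hbad
    have hlt := hl.lt_sum_of_excess_risk P hA hε hε0 hxG hj hpos
      (hsel (startTime M ε x n j) (hist _ x)) (hsel_le _ _ x rfl) hbad
    set s := numUpdates M ε j n x with hs
    have hsn : (s : ℝ) * (1 / (n + 1)) ≤ 1 := by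
      rw [mul_one_div, div_le_one (by positivity)]
      exact_mod_cast (numUpdates_le M ε j n x).trans n.le_succ
    have hms' : (m : ℝ) ≤ s := by exact_mod_cast hms
    have hcard : ((updates M ε j n x).card : ℝ) = s := rfl
    have hsum : ∑ t ∈ Finset.range n, logIncrement P (fun t x => j ∈ closeSet M ε x t)
        (fun t x z => loss (cmp t x z) z - loss (hyp t x z) z) α t x (x t) =
        α * ∑ t ∈ updates M ε j n x,
          ((loss (sel (startTime M ε x n j) (hist _ x) (x t)) (x t) - loss (hyp t x (x t)) (x t)) -
          (risk P loss (sel (startTime M ε x n j) (hist _ x)) t x - risk P loss (hyp t x) t x))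
          - s * (α ^ 2 / 2) := by
      classical
      unfold logIncrement
      have hupd : updates M ε j n x = (Finset.range n).filter (fun t => j ∈ closeSet M ε x t) := by
        ext t; simp [mem_updates]
      rw [← hcard, ← nsmul_eq_mul, ← Finset.sum_const, Finset.mul_sum,
        ← Finset.sum_sub_distrib, hupd, Finset.sum_filter]
      refine Finset.sum_congr rfl fun t ht => ?_
      by_cases htj : j ∈ closeSet M ε x t
      · rw [if_pos htj, if_pos htj, hint]
        simp only [cmp]
        rw [startTime_eq M ε (Finset.mem_range.1 ht).le htj]
      · rw [if_neg htj, if_neg htj]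
    rw [hsum]
    have h1 := mul_le_mul_of_nonneg_left hlt.le hα.1
    have h2 : m * (α ^ 2 / 2) ≤ s * (α ^ 2 / 2) := by gcongr
    have h3 : α * (1 + s * (1 / (n + 1) : ℝ)) ≤ 1 * 2 := by
      refine mul_le_mul hα.2 (by linarith) (by positivity) zero_le_one
    simp only [hyp]
    linarith

end SubroutineBound

/-- The pieces are the events on which the update set, or also the active index, takes a given
value; there the random index sets become constants. -/
lemma aemeasurable_of_forall_eqOn {X ι : Type*} [MeasurableSpace X] [Countable ι] {μ : Measure X}
    {f : X → ℝ} {s : ι → Set X} (hs : ∀ i, MeasurableSet (s i)) (hcover : ⋃ i, s i = Set.univ)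
    {F : ι → X → ℝ} (hF : ∀ i, AEMeasurable (F i) μ) (hfF : ∀ i, Set.EqOn f (F i) (s i)) :
    AEMeasurable f μ := by
  rw [← Measure.restrict_univ (μ := μ), ← hcover, aemeasurable_iUnion_iff]
  exact fun i => (hF i).restrict.congr
    ((ae_restrict_mem (hs i)).mono fun x hx => (hfF i hx).symm)

/-! ### Measurability of the procedure, its regret and its risk. -/

section MeasurableEvents

variable {Z : Type*} [MeasurableSpace Z] {M : Bounds Z} {ε : ℕ → ℝ}

lemma measurableSet_mem_closeIn (hM : ∀ i j, Measurable (M i j)) (t j : ℕ) (L : List ℕ) :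
    MeasurableSet {x : ℕ → Z | j ∈ closeIn M ε x t L} := by
  simp only [closeIn, Finset.mem_filter, Finset.mem_range]
  exact (MeasurableSet.const _).inter
    (measurableSet_le ((hM _ _).comp (measurable_hist _)) measurable_const)

lemma measurableSet_closeIn_eq_empty (hM : ∀ i j, Measurable (M i j)) (t : ℕ) (L : List ℕ) :
    MeasurableSet {x : ℕ → Z | closeIn M ε x t L = ∅} := by
  simp only [Finset.eq_empty_iff_forall_notMem, Set.ofPred_forall]
  exact MeasurableSet.iInter fun j => (measurableSet_mem_closeIn hM t j L).compl

lemma measurableSet_starts_eq (hM : ∀ i j, Measurable (M i j)) (t : ℕ) (L : List ℕ) :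
    MeasurableSet {x : ℕ → Z | starts M ε x t = L} := by
  induction t generalizing L with
  | zero => simp only [starts]; exact MeasurableSet.const _
  | succ t ih =>
    have : {x : ℕ → Z | starts M ε x (t + 1) = L} = ⋃ L' : List ℕ, {x | starts M ε x t = L'} ∩
        (({x | closeIn M ε x t L' = ∅} ∩ {_x | L' ++ [t] = L}) ∪
          ({x | closeIn M ε x t L' = ∅}ᶜ ∩ {_x | L' = L})) := by
      ext x
      simp only [Set.mem_ofPred_eq, Set.mem_iUnion, Set.mem_inter_iff, Set.mem_union,
        Set.mem_compl_iff, exists_eq_left', starts]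
      split_ifs with h <;> simp [h]
    rw [this]
    exact MeasurableSet.iUnion fun L' => (ih L').inter
      (((measurableSet_closeIn_eq_empty hM t L').inter (MeasurableSet.const _)).union
        ((measurableSet_closeIn_eq_empty hM t L').compl.inter (MeasurableSet.const _)))

lemma measurableSet_mem_closeSet (hM : ∀ i j, Measurable (M i j)) (t j : ℕ) :
    MeasurableSet {x : ℕ → Z | j ∈ closeSet M ε x t} := by
  have : {x : ℕ → Z | j ∈ closeSet M ε x t} = ⋃ L : List ℕ, {x | starts M ε x t = L} ∩
      (({x | closeIn M ε x t L = ∅} ∩ {_x | j = L.length}) ∪ {x | j ∈ closeIn M ε x t L}) := by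
    ext x
    simp only [Set.mem_ofPred_eq, Set.mem_iUnion, Set.mem_inter_iff, Set.mem_union,
      exists_eq_left', mem_closeSet_iff]
  rw [this]
  exact MeasurableSet.iUnion fun L => (measurableSet_starts_eq hM t L).inter
    (((measurableSet_closeIn_eq_empty hM t L).inter (MeasurableSet.const _)).union
      (measurableSet_mem_closeIn hM t j L))

lemma measurableSet_updates_eq (hM : ∀ i j, Measurable (M i j)) (j n : ℕ) (C : Finset ℕ) :
    MeasurableSet {x : ℕ → Z | updates M ε j n x = C} := by
  simp only [Finset.ext_iff, mem_updates, Set.ofPred_forall]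
  refine MeasurableSet.iInter fun t => ?_
  have h : MeasurableSet {x : ℕ → Z | t < n ∧ j ∈ closeSet M ε x t} :=
    (MeasurableSet.const _).inter (measurableSet_mem_closeSet hM t j)
  by_cases ht : t ∈ C
  · simpa [ht] using h
  · simp only [ht, iff_false]; exact h.compl

lemma measurableSet_le_numUpdates (hM : ∀ i j, Measurable (M i j)) (j n m : ℕ) :
    MeasurableSet {x : ℕ → Z | m ≤ numUpdates M ε j n x} := by
  have : {x : ℕ → Z | m ≤ numUpdates M ε j n x} =
      ⋃ C : Finset ℕ, {x | updates M ε j n x = C} ∩ {_x | m ≤ C.card} := by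
    ext x
    simp only [Set.mem_ofPred_eq, Set.mem_iUnion, Set.mem_inter_iff, exists_eq_left', numUpdates]
  rw [this]
  exact MeasurableSet.iUnion fun C => (measurableSet_updates_eq hM j n C).inter (.const _)

lemma measurableSet_active_eq {I : (n : ℕ) → (Fin n → Z) → ℕ} (hI : IsActiveRule M ε I)
    (n j : ℕ) : MeasurableSet {x : ℕ → Z | I n (hist n x) = j} :=
  ((hI.measurable n).comp (measurable_hist n)) (measurableSet_singleton j)

end MeasurableEvents

section UpdateTimes

variable {Z E : Type*} {M : Bounds Z} {ε : ℕ → ℝ}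

/-- The observations at the times in `C`, in increasing order. -/
noncomputable def pick (C : Finset ℕ) (i : ℕ) (x : ℕ → Z) : Fin i → Z :=
  fun k => x (Nat.nth (fun t => t ∈ C) k)

lemma hist_feed_eq_pick {j n i : ℕ} {x : ℕ → Z} {C : Finset ℕ} (hx : updates M ε j n x = C)
    (hi : i ≤ C.card) : hist i (feed M ε j x) = pick C i x := by
  subst hx
  exact funext fun k => feed_eq_nth_updates M ε (k.2.trans_le hi)

variable [AddCommGroup E] [Module ℝ E] {A : OnlineAlg Z E} {I : (n : ℕ) → (Fin n → Z) → ℕ}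

/-- The output of the meta-algorithm, as a function of the path, if the active subroutine has been
updated at the times in `C`. -/
noncomputable def outputAt (A : OnlineAlg Z E) (C : Finset ℕ) (x : ℕ → Z) : Z → E :=
  if C.card = 0 then A 0 (pick C 0 x)
  else (C.card : ℝ)⁻¹ • ∑ i ∈ Finset.range C.card, A (i + 1) (pick C (i + 1) x)

lemma output_eq_outputAt {n : ℕ} {x : ℕ → Z} {C : Finset ℕ}
    (hx : updates M ε (I n (hist n x)) n x = C) : output M ε A I n x = outputAt A C x := by
  have hcard : numUpdates M ε (I n (hist n x)) n x = C.card := congrArg _ hx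
  unfold output outputAt
  rw [hcard]
  split_ifs with h
  · unfold subHyp
    rw [hist_feed_eq_pick hx (Nat.zero_le _)]
  · congr 1
    refine Finset.sum_congr rfl fun i hi => ?_
    unfold subHyp
    rw [hist_feed_eq_pick hx (Finset.mem_range.1 hi)]

end UpdateTimes

section MeasurableRisk

variable {Z E : Type*} [MeasurableSpace Z] [AddCommGroup E] [Module ℝ E] [MeasurableSpace E]
  {D : Set E} {loss : E → Z → ℝ} {H : Set (Z → E)} {A : OnlineAlg Z E} {M : Bounds Z} {ε : ℕ → ℝ}
  {I : (n : ℕ) → (Fin n → Z) → ℕ}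

lemma measurable_pick (C : Finset ℕ) (i : ℕ) : Measurable (pick (Z := Z) C i) :=
  measurable_pi_lambda _ fun _ => measurable_pi_apply _

lemma IsBoundedConvexLoss.aemeasurable_subRegret (hl : IsBoundedConvexLoss D loss H)
    (hA : ∀ i y, A i y ∈ H) (hAm : ∀ i, Measurable fun p : (Fin i → Z) × Z => A i p.1 p.2)
    (hM : ∀ i j, Measurable (M i j)) {P : StochProc Z} (hP : Admissible M loss H P) (j n : ℕ) :
    AEMeasurable (subRegret M ε loss H A j n) P.law := by
  refine aemeasurable_of_forall_eqOn (fun C => measurableSet_updates_eq (ε := ε) hM j n C)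
    (Set.eq_univ_of_forall fun x => Set.mem_iUnion.2 ⟨updates M ε j n x, rfl⟩)
    (F := fun C x => ∑ i ∈ Finset.range C.card, loss (A i (pick C i x)
      (x (Nat.nth (fun t => t ∈ C) i))) (x (Nat.nth (fun t => t ∈ C) i)) -
        ⨅ h : H, ∑ t ∈ C, loss ((h : Z → E) (x t)) (x t)) (fun C => ?_) (fun C x hx => ?_)
  · refine (Measurable.aemeasurable ?_).sub (hP.aemeasurable_minLoss C)
    refine Finset.measurable_sum _ fun i _ => ?_
    exact hl.measurable_comp ((hAm i).comp ((measurable_pick C i).prodMk (measurable_pi_apply _)))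
      (measurable_pi_apply _) fun x => hl.mem _ (hA _ _) _
  · have hx : updates M ε j n x = C := hx
    have hcard : numUpdates M ε j n x = C.card := congrArg _ hx
    unfold subRegret regret
    rw [hcard]
    congr 1
    · refine Finset.sum_congr rfl fun i hi => ?_
      have hi := Finset.mem_range.1 hi
      rw [hist_feed_eq_pick hx hi.le, feed_eq_nth_updates M ε (hcard ▸ hi), hx]
    · refine iInf_congr fun h => ?_
      rw [← hcard, sum_range_feed M ε j n x fun _ z => loss ((h : Z → E) z) z, hx]

lemma IsBoundedConvexLoss.outputAt_mem (hl : IsBoundedConvexLoss D loss H)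
    (hA : ∀ i y, A i y ∈ H) (C : Finset ℕ) (x : ℕ → Z) (z : Z) : outputAt A C x z ∈ D := by
  unfold outputAt
  split_ifs with h
  · exact hl.mem _ (hA _ _) z
  · exact hl.average_mem h (fun i => hA _ _) z

lemma measurable_outputAt [MeasurableAdd₂ E] [MeasurableConstSMul ℝ E]
    (hAm : ∀ i, Measurable fun p : (Fin i → Z) × Z => A i p.1 p.2) (C : Finset ℕ) :
    Measurable fun p : (ℕ → Z) × Z => outputAt A C p.1 p.2 := by
  have h (i : ℕ) : Measurable fun p : (ℕ → Z) × Z => A i (pick C i p.1) p.2 :=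
    (hAm i).comp (((measurable_pick C i).comp measurable_fst).prodMk measurable_snd)
  unfold outputAt
  split_ifs with hC
  · exact h 0
  · simp only [Pi.smul_apply, Finset.sum_apply]
    exact (Finset.measurable_sum _ fun i _ => h (i + 1)).const_smul _

lemma IsBoundedConvexLoss.measurable_risk_outputAt [MeasurableAdd₂ E] [MeasurableConstSMul ℝ E]
    (hl : IsBoundedConvexLoss D loss H) (hA : ∀ i y, A i y ∈ H)
    (hAm : ∀ i, Measurable fun p : (Fin i → Z) × Z => A i p.1 p.2) (P : StochProc Z) (n : ℕ)
    (C : Finset ℕ) : Measurable fun x => risk P loss (outputAt A C x) n x := by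
  have h : Measurable fun p : (ℕ → Z) × Z => loss (outputAt A C p.1 p.2) p.2 :=
    hl.measurable_comp (measurable_outputAt hAm C) measurable_snd
      fun p => hl.outputAt_mem hA C p.1 p.2
  exact (h.stronglyMeasurable.integral_kernel_prod_right'
    (κ := (P.cond n).comap (hist n) (measurable_hist n))).measurable

lemma IsBoundedConvexLoss.nullMeasurableSet_excessEvent [MeasurableAdd₂ E]
    [MeasurableConstSMul ℝ E] (hl : IsBoundedConvexLoss D loss H) (hA : ∀ i y, A i y ∈ H)
    (hAm : ∀ i, Measurable fun p : (Fin i → Z) × Z => A i p.1 p.2)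
    (hM : ∀ i j, Measurable (M i j)) (hI : IsActiveRule M ε I) {P : StochProc Z}
    (hP : Admissible M loss H P) (α : ℝ) (n : ℕ) :
    NullMeasurableSet (excessEvent loss H A M ε I P α n) P.law := by
  let s (c : ℕ × Finset ℕ) : Set (ℕ → Z) :=
    {x | I n (hist n x) = c.1} ∩ {x | updates M ε c.1 n x = c.2}
  have hs (c : ℕ × Finset ℕ) : MeasurableSet (s c) :=
    (measurableSet_active_eq hI n c.1).inter (measurableSet_updates_eq hM c.1 n c.2)
  have hcover : ⋃ c, s c = Set.univ :=
    Set.eq_univ_of_forall fun x => Set.mem_iUnion.2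
      ⟨(I n (hist n x), updates M ε (I n (hist n x)) n x), rfl, rfl⟩
  refine nullMeasurableSet_lt ?_ ?_
  · refine aemeasurable_of_forall_eqOn hs hcover (F := fun c x =>
      α + subRegret M ε loss H A c.1 n x / c.2.card + 4 / c.2.card * ∑ t ∈ c.2, ε t)
      (fun c => ?_) ?_
    · exact (((hl.aemeasurable_subRegret hA hAm hM hP c.1 n).div_const _).const_add α).add_const _
    · rintro ⟨j, C⟩ x ⟨hj, hC⟩
      have hj : I n (hist n x) = j := hj
      have hC : updates M ε j n x = C := hC
      simp only [hj, numUpdates, hC]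
  · refine aemeasurable_of_forall_eqOn hs hcover (F := fun c x =>
      risk P loss (outputAt A c.2 x) n x - minRisk P loss H n x) (fun c => ?_) ?_
    · exact (hl.measurable_risk_outputAt hA hAm P n c.2).aemeasurable.sub
        (hP.aemeasurable_minRisk n)
    · rintro ⟨j, C⟩ x ⟨hj, hC⟩
      have hj : I n (hist n x) = j := hj
      have hC : updates M ε j n x = C := hC
      simp only
      rw [output_eq_outputAt (by rw [hj, hC])]

end MeasurableRisk

/-! ### Union bound and comparison of constants. -/

lemma one_le_seqCoveringNumber {Z : Type*} [Nonempty Z] {F : Set (Z → ℝ)} (hF : F.Nonempty)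
    (θ : ℝ) (n : ℕ) : 1 ≤ seqCoveringNumber F θ n := by
  obtain ⟨f, hf⟩ := hF
  let z : Tree n Z := fun _ _ => Classical.arbitrary Z
  refine le_iSup_of_le z (le_iInf fun V => ?_)
  obtain ⟨v, hv, -⟩ := V.2 f hf fun _ => true
  exact Set.one_le_encard_iff_nonempty.2 ⟨v, hv⟩

section RiskBound

variable {Z E : Type*} [MeasurableSpace Z] {M : Bounds Z} {ε : ℕ → ℝ}
  {I : (n : ℕ) → (Fin n → Z) → ℕ}

lemma measure_active_eq_zero {P : StochProc Z} {n j : ℕ} (hj : j ∉ activeSupport P I n) :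
    P.law {x | I n (hist n x) = j} = 0 := by
  simpa [activeSupport] using hj

lemma measure_active_notMem_activeSupport (P : StochProc Z) (n : ℕ) :
    P.law {x | I n (hist n x) ∉ activeSupport P I n} = 0 := by
  refine measure_mono_null (t := ⋃ j : {j // j ∉ activeSupport P I n}, {x | I n (hist n x) = j})
    (fun x hx => Set.mem_iUnion.2 ⟨⟨_, hx⟩, rfl⟩)
    (measure_iUnion_null fun j => measure_active_eq_zero j.2)

variable [AddCommGroup E] [Module ℝ E] [MeasurableSpace E] [MeasurableAdd₂ E]
  [MeasurableConstSMul ℝ E] {D : Set E} {loss : E → Z → ℝ} {H : Set (Z → E)} {A : OnlineAlg Z E}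

lemma IsBoundedConvexLoss.measure_excessEvent_le (hl : IsBoundedConvexLoss D loss H)
    (hA : ∀ i y, A i y ∈ H) (hAm : ∀ i, Measurable fun p : (Fin i → Z) × Z => A i p.1 p.2)
    (hM : ∀ i j, Measurable (M i j)) (hε : Antitone ε) (hε0 : ∀ t, 0 ≤ ε t)
    (hI : IsActiveRule M ε I) {P : StochProc Z} (hP : Admissible M loss H P) {α : ℝ}
    (hα : α ∈ Set.Icc (0 : ℝ) 1) (n k : ℕ) {m : ℕ} (hm : 1 ≤ m) :
    P.law (excessEvent loss H A M ε I P α n) ≤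
      k * ENNReal.ofReal (Real.exp (-(m * α ^ 2 / 2 - 2))) + P.law (favourable M ε P I k m n)ᶜ := by
  by_cases hk : (activeSupport P I n).encard ≤ k
  swap
  -- With too large a support no realization is favourable, and the exceptional set is everything.
  · refine le_add_left (measure_mono fun x _ hx => hk hx.1)
  have hfin : (activeSupport P I n).Finite := Set.finite_of_encard_le_coe hk
  let B (j : ℕ) : Set (ℕ → Z) := excessEvent loss H A M ε I P α n ∩
    {x | I n (hist n x) = j ∧ m ≤ numUpdates M ε j n x}
  have hB (j : ℕ) : P.law (B j) ≤ ENNReal.ofReal (Real.exp (-(m * α ^ 2 / 2 - 2))) :=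
    hl.measure_excessEvent_inter_le hA hε hε0 hI hP hα hm
      ((hl.nullMeasurableSet_excessEvent hA hAm hM hI hP α n).inter
        ((measurableSet_active_eq hI n j).inter
          (measurableSet_le_numUpdates hM j n m)).nullMeasurableSet) subset_rfl
  have hsub : excessEvent loss H A M ε I P α n ⊆ (⋃ j ∈ hfin.toFinset, B j) ∪
      ((favourable M ε P I k m n)ᶜ ∪ {x | I n (hist n x) ∉ activeSupport P I n}) := by
    intro x hx
    by_cases h1 : x ∈ favourable M ε P I k m n
    · by_cases h2 : I n (hist n x) ∈ activeSupport P I n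
      · exact Or.inl (Set.mem_biUnion (hfin.mem_toFinset.2 h2) ⟨hx, rfl, h1.2 _ h2⟩)
      · exact Or.inr (Or.inr h2)
    · exact Or.inr (Or.inl h1)
  have hcard : (hfin.toFinset.card : ℝ≥0∞) ≤ k := by
    rw [hfin.encard_eq_coe_toFinset_card] at hk
    exact_mod_cast hk
  calc P.law (excessEvent loss H A M ε I P α n)
      ≤ P.law (⋃ j ∈ hfin.toFinset, B j) + (P.law (favourable M ε P I k m n)ᶜ +
        P.law {x | I n (hist n x) ∉ activeSupport P I n}) :=
        (measure_mono hsub).trans ((measure_union_le _ _).trans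
          (add_le_add_right (measure_union_le _ _) _))
    _ ≤ k * ENNReal.ofReal (Real.exp (-(m * α ^ 2 / 2 - 2)))
        + P.law (favourable M ε P I k m n)ᶜ := by
      rw [measure_active_notMem_activeSupport, add_zero]
      refine add_le_add_left ?_ _
      calc P.law (⋃ j ∈ hfin.toFinset, B j) ≤ ∑ j ∈ hfin.toFinset, P.law (B j) :=
            measure_biUnion_finset_le _ _
        _ ≤ ∑ _j ∈ hfin.toFinset, ENNReal.ofReal (Real.exp (-(m * α ^ 2 / 2 - 2))) :=
            Finset.sum_le_sum fun j _ => hB j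
        _ ≤ _ := by
            rw [Finset.sum_const, nsmul_eq_mul]
            exact mul_le_mul_left hcard _

lemma exp_bound_le {α β : ℝ} (hα : α ∈ Set.Icc (0 : ℝ) 1) (hβ : β ∈ Set.Icc (0 : ℝ) (α / 8))
    (k m : ℕ) {N : ℝ≥0∞} (hN : 1 ≤ N) :
    k * ENNReal.ofReal (Real.exp (-(m * α ^ 2 / 2 - 2))) ≤
      4 * (k : ℝ≥0∞) * N / ENNReal.ofReal ((α / 2 - 4 * β) ^ 2)
        * ENNReal.ofReal (Real.exp (-(1 / 2) * m * (α / 2 - 4 * β) ^ 2)) := by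
  obtain ⟨hα0, hα1⟩ := hα
  obtain ⟨hβ0, hβ1⟩ := hβ
  set γ := α / 2 - 4 * β with hγ
  have hγ0 : 0 ≤ γ := by linarith
  have hγα : γ ≤ α := by linarith
  have hγ2 : γ ^ 2 ≤ 1 / 4 := by nlinarith
  -- The loss `exp 2` is absorbed by `16 = 4 * 4`: one factor stands in the bound, the other is at
  -- most `1 / γ ^ 2` because `γ ≤ 1 / 2`. For `γ = 0` that inverse is `⊤`.
  have hexp2 : Real.exp 2 ≤ 16 := by
    have h := Real.exp_one_lt_d9
    have : Real.exp 2 = Real.exp 1 ^ 2 := by rw [← Real.exp_nat_mul]; norm_num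
    rw [this]
    nlinarith [Real.exp_pos 1]
  have h1 : ENNReal.ofReal (Real.exp (-(m * α ^ 2 / 2 - 2))) ≤
      16 * ENNReal.ofReal (Real.exp (-(1 / 2) * m * γ ^ 2)) := by
    have : (16 : ℝ≥0∞) = ENNReal.ofReal 16 := by simp
    rw [this, ← ENNReal.ofReal_mul (by norm_num)]
    refine ENNReal.ofReal_le_ofReal ?_
    calc Real.exp (-(m * α ^ 2 / 2 - 2)) ≤ Real.exp (2 + -(1 / 2) * m * γ ^ 2) := by
          refine Real.exp_le_exp.2 ?_
          have : (m : ℝ) * γ ^ 2 ≤ m * α ^ 2 := by gcongr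
          linarith
      _ ≤ 16 * Real.exp (-(1 / 2) * m * γ ^ 2) := by
          rw [Real.exp_add]; gcongr
  have h2 : (4 : ℝ≥0∞) ≤ (ENNReal.ofReal (γ ^ 2))⁻¹ := by
    rw [ENNReal.le_inv_iff_le_inv]
    refine (ENNReal.ofReal_le_ofReal hγ2).trans_eq ?_
    rw [one_div, ENNReal.ofReal_inv_of_pos (by norm_num)]; simp
  calc k * ENNReal.ofReal (Real.exp (-(m * α ^ 2 / 2 - 2)))
      ≤ k * (16 * ENNReal.ofReal (Real.exp (-(1 / 2) * m * γ ^ 2))) := by gcongr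
    _ = 4 * (k : ℝ≥0∞) * 1 * 4 * ENNReal.ofReal (Real.exp (-(1 / 2) * m * γ ^ 2)) := by ring
    _ ≤ _ := by
          rw [div_eq_mul_inv]
          exact mul_le_mul' (mul_le_mul' (mul_le_mul' le_rfl hN) h2) le_rfl

end RiskBound

/-- The tail unions decrease to the empty set, so continuity from above applies. -/
lemma tendsto_measure_zero_of_eventually_notMem {X : Type*} [MeasurableSpace X] (μ : Measure X)
    [IsFiniteMeasure μ] {s : ℕ → Set X} (hs : ∀ n, NullMeasurableSet (s n) μ)
    (h : ∀ x, ∀ᶠ n in atTop, x ∉ s n) : Tendsto (fun n => μ (s n)) atTop (𝓝 0) := by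
  let U (N : ℕ) : Set X := ⋃ n ≥ N, s n
  have hU : Antitone U := fun N N' hN =>
    Set.biUnion_subset_biUnion_left fun n (hn : N' ≤ n) => hN.trans hn
  have hUm (N : ℕ) : NullMeasurableSet (U N) μ :=
    .iUnion fun n => .iUnion fun _ => hs n
  have hempty : ⋂ N, U N = ∅ := by
    refine Set.eq_empty_of_forall_notMem fun x hx => ?_
    obtain ⟨N, hN⟩ := eventually_atTop.1 (h x)
    obtain ⟨n, hn, hxn⟩ := Set.mem_iUnion₂.1 (Set.mem_iInter.1 hx N)
    exact hN n hn hxn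
  have hlim := tendsto_measure_iInter_atTop hUm hU ⟨0, measure_ne_top μ _⟩
  rw [hempty, measure_empty] at hlim
  exact tendsto_of_tendsto_of_tendsto_of_le_of_le tendsto_const_nhds hlim (fun _ => zero_le)
    fun n => measure_mono (Set.subset_biUnion_of_mem (u := s) (le_refl n))

/-! ### Almost surely only finitely many subroutines. -/

section FinitelyManySubroutines

variable {Z : Type*} {M : Bounds Z} {ε : ℕ → ℝ}

lemma exists_creation {x : ℕ → Z} {t j : ℕ} (hj : j < (starts M ε x t).length) :
    ∃ t' < t, closeIn M ε x t' (starts M ε x t') = ∅ ∧ (starts M ε x t').length = j := by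
  induction t with
  | zero => simp [starts] at hj
  | succ t ih =>
    by_cases h : j < (starts M ε x t).length
    · obtain ⟨t', ht', h⟩ := ih h
      exact ⟨t', ht'.trans t.lt_succ_self, h⟩
    · obtain he | ⟨h0, he⟩ := starts_succ_eq M ε x t <;> rw [he] at hj
      · exact absurd hj h
      · rw [List.length_append, List.length_singleton] at hj
        exact ⟨t, t.lt_succ_self, h0, by lia⟩

lemma active_of_creation [MeasurableSpace Z] {I : (n : ℕ) → (Fin n → Z) → ℕ}
    (hI : IsActiveRule M ε I) {x : ℕ → Z} {t : ℕ}
    (h : closeIn M ε x t (starts M ε x t) = ∅) :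
    I t (hist t x) = (starts M ε x t).length := by
  have := hI.mem t x
  rwa [closeSet, if_pos h, Finset.mem_singleton] at this

/-- If favourable realizations have positive probability from time `n₀` on, then almost surely no
subroutine with an index of at least `n₀` is created. -/
lemma measure_active_eq_zero_of_le [MeasurableSpace Z] {I : (n : ℕ) → (Fin n → Z) → ℕ}
    (hI : IsActiveRule M ε I) (P : StochProc Z) {k m : ℕ → ℕ} {n₀ : ℕ}
    (hm : ∀ n ≥ n₀, 1 ≤ m n) (hfav : ∀ n ≥ n₀, P.law (favourable M ε P I (k n) (m n) n)ᶜ < 1)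
    {j : ℕ} (hj : n₀ ≤ j) (n : ℕ) : P.law {x | I n (hist n x) = j} = 0 := by
  let Cr (t : ℕ) : Set (ℕ → Z) :=
    {x | closeIn M ε x t (starts M ε x t) = ∅ ∧ (starts M ε x t).length = j}
  have hCr (t : ℕ) : P.law (Cr t) = 0 := by
    induction t using Nat.strong_induction_on with
    | _ t ih =>
      by_contra hne
      obtain ⟨x₀, -, hx₀⟩ := nonempty_of_measure_ne_zero hne
      -- At most one subroutine is created per step, so number `j` cannot appear before step `j`.
      have ht : n₀ ≤ t := hj.trans (hx₀ ▸ length_starts_le M ε x₀ t)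
      have hsupp : j ∈ activeSupport P I t :=
        (pos_iff_ne_zero.2 hne).trans_le
          (measure_mono fun x hx => (active_of_creation hI hx.1).trans hx.2)
      -- Creation at `t` with positive probability puts `j` in the support, so on favourable paths
      -- `j` has been updated before `t`. It was then created earlier, which is a null event by
      -- induction.
      have hnull : P.law (favourable M ε P I (k t) (m t) t) = 0 := by
        refine measure_mono_null (t := ⋃ t' : Fin t, Cr t') (fun x hx => ?_)
          (measure_iUnion_null fun t' => ih t' t'.2)
        have hpos : 0 < numUpdates M ε j t x := (hm t ht).trans (hx.2 j hsupp)
        obtain ⟨t₁, ht₁⟩ := Finset.card_pos.1 hpos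
        obtain ⟨htt, hjt⟩ := (mem_updates M ε).1 ht₁
        obtain ⟨t', ht', hc⟩ := exists_creation (lt_length_of_mem_closeSet M ε hjt)
        exact Set.mem_iUnion.2 ⟨⟨t', by lia⟩, hc⟩
      have h1 : (1 : ℝ≥0∞) ≤ P.law (favourable M ε P I (k t) (m t) t)ᶜ := by
        calc (1 : ℝ≥0∞) = P.law (favourable M ε P I (k t) (m t) t ∪
              (favourable M ε P I (k t) (m t) t)ᶜ) := by rw [Set.union_compl_self, measure_univ]
          _ ≤ _ := (measure_union_le _ _).trans (by rw [hnull, zero_add])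
      exact absurd (hfav t ht) (not_lt.2 h1)
  refine measure_mono_null (t := ⋃ t, Cr t) (fun x hx => ?_) (measure_iUnion_null hCr)
  have hx : I n (hist n x) = j := hx
  obtain ⟨t', -, hc⟩ := exists_creation (lt_length_of_mem_closeSet M ε (hx ▸ hI.mem n x))
  exact Set.mem_iUnion.2 ⟨t', hc⟩

/-- The update numbered `i` (from `0`) takes place no earlier than step `i`. Cesàro convergence of
`ε` then controls the average threshold whatever the update times are. -/
lemma sum_updates_le (hε : Antitone ε) (j n : ℕ) (x : ℕ → Z) :
    ∑ t ∈ updates M ε j n x, ε t ≤ ∑ i ∈ Finset.range (numUpdates M ε j n x), ε i := by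
  rw [sum_range_feed M ε j n x fun i _ => ε i]
  exact Finset.sum_le_sum fun t _ => hε (numUpdates_le M ε j t x)

end FinitelyManySubroutines

section OutputProperties

variable {Z E : Type*} [AddCommGroup E] [Module ℝ E] {M : Bounds Z} {ε : ℕ → ℝ}
  (A : OnlineAlg Z E) (I : (n : ℕ) → (Fin n → Z) → ℕ)

lemma dependsOn_output (n : ℕ) : DependsOn (output M ε A I n) (Set.Iio n) := by
  intro x x' h
  have h : ∀ i < n, x i = x' i := fun i hi => h i hi
  have hI : I n (hist n x) = I n (hist n x') := by rw [hist_congr h]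
  unfold output
  rw [← hI, ← numUpdates_congr M ε h]
  split_ifs with hs
  · exact subHyp_congr M ε A h (Nat.zero_le _)
  · congr 1
    exact Finset.sum_congr rfl fun i hi =>
      subHyp_congr M ε A h (Nat.succ_le_of_lt (Finset.mem_range.1 hi))

variable {A}

lemma output_mem {H : Set (Z → E)} (hA : ∀ i y, A i y ∈ H) (hH : Convex ℝ H) (n : ℕ) (x : ℕ → Z) :
    output M ε A I n x ∈ H := by
  unfold output
  split_ifs with hs
  · exact hA _ _
  · rw [Finset.smul_sum]
    exact hH.sum_mem (fun _ _ => by positivity) (sum_range_inv hs) fun i _ => hA _ _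

end OutputProperties

lemma tendsto_atTop_of_div_log {m : ℕ → ℕ}
    (h : Tendsto (fun n => (m n : ℝ) / Real.log n) atTop atTop) :
    Tendsto m atTop atTop := by
  have hlog : Tendsto (fun n : ℕ => Real.log n) atTop atTop :=
    Real.tendsto_log_atTop.comp tendsto_natCast_atTop_atTop
  refine tendsto_natCast_atTop_iff.1 ((h.atTop_mul_atTop₀ hlog).congr' ?_)
  filter_upwards [hlog.eventually_gt_atTop 0] with n hn
  exact div_mul_cancel₀ _ hn.ne'

/-! ### Convergence of the excess risk. -/

section Learning

variable {Z E : Type*} [MeasurableSpace Z] [AddCommGroup E] [Module ℝ E] [MeasurableSpace E]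
  {D : Set E} {loss : E → Z → ℝ} {H : Set (Z → E)}
  {A : OnlineAlg Z E} {M : Bounds Z} {ε : ℕ → ℝ} {I : (n : ℕ) → (Fin n → Z) → ℕ}

/-- For a fixed `j`, Hannan consistency on the sequence `feed M ε j x` shows that each path
eventually leaves these events, at a time that depends on the path and on `j`. -/
lemma IsBoundedConvexLoss.tendsto_measure_subRegret (hl : IsBoundedConvexLoss D loss H)
    (hA : ∀ i y, A i y ∈ H) (hAm : ∀ i, Measurable fun p : (Fin i → Z) × Z => A i p.1 p.2)
    (hM : ∀ i j, Measurable (M i j)) {P : StochProc Z} (hP : Admissible M loss H P)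
    (hH : HannanConsistent loss H A) {m : ℕ → ℕ} (hm : Tendsto m atTop atTop) (j : ℕ) {δ : ℝ}
    (hδ : 0 < δ) :
    Tendsto (fun n => P.law {x | m n ≤ numUpdates M ε j n x ∧
      δ < subRegret M ε loss H A j n x / numUpdates M ε j n x}) atTop (𝓝 0) := by
  refine tendsto_measure_zero_of_eventually_notMem _ (fun n => ?_) fun x => ?_
  · have hlt : NullMeasurableSet {x | δ < subRegret M ε loss H A j n x / numUpdates M ε j n x}
        P.law := nullMeasurableSet_lt aemeasurable_const ?_
    · exact (measurableSet_le_numUpdates hM j n (m n)).nullMeasurableSet.inter hlt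
    refine (hl.aemeasurable_subRegret hA hAm hM hP j n).div (Measurable.aemeasurable ?_)
    refine (measurable_from_top (f := fun s : ℕ => (s : ℝ))).comp
      (measurable_of_Ici fun s => measurableSet_le_numUpdates hM j n s)
  · obtain ⟨s₀, hs₀⟩ := eventually_atTop.1 (hH (feed M ε j x) δ hδ)
    filter_upwards [hm.eventually_ge_atTop s₀] with n hn
    rintro ⟨h1, h2⟩
    exact absurd h2 (not_lt.2 (hs₀ _ (hn.trans h1)))

lemma IsBoundedConvexLoss.tendsto_measure_excess_risk [MeasurableAdd₂ E] [MeasurableConstSMul ℝ E]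
    (hl : IsBoundedConvexLoss D loss H)
    (hA : ∀ i y, A i y ∈ H) (hAm : ∀ i, Measurable fun p : (Fin i → Z) × Z => A i p.1 p.2)
    (hM : ∀ i j, Measurable (M i j)) (hε : Antitone ε) (hε_lim : Tendsto ε atTop (𝓝 0))
    (hI : IsActiveRule M ε I) {P : StochProc Z} (hP : Admissible M loss H P)
    (hH : HannanConsistent loss H A) {k m : ℕ → ℕ} (hm : Tendsto m atTop atTop)
    (hfav : Tendsto (fun n => P.law (favourable M ε P I (k n) (m n) n)ᶜ) atTop (𝓝 0))
    {δ : ℝ} (hδ : 0 < δ) :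
    Tendsto (fun n => P.law {x | risk P loss (output M ε A I n x) n x - minRisk P loss H n x > δ})
      atTop (𝓝 0) := by
  have hε0 : ∀ t, 0 ≤ ε t := fun t => hε.le_of_tendsto hε_lim t
  obtain ⟨n₀, hn₀⟩ := eventually_atTop.1
    ((hm.eventually_ge_atTop 1).and (hfav.eventually_lt_const one_pos))
  have hnull : ∀ j ≥ n₀, ∀ n, P.law {x | I n (hist n x) = j} = 0 := fun j hj n =>
    measure_active_eq_zero_of_le hI P (fun n hn => (hn₀ n hn).1) (fun n hn => (hn₀ n hn).2) hj n
  have hsupp (n : ℕ) : activeSupport P I n ⊆ Set.Iio n₀ := fun j hj => by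
    by_contra hjn
    exact hj.ne' (hnull j (not_lt.1 hjn) n)
  have hcard (n : ℕ) : (activeSupport P I n).encard ≤ n₀ :=
    (Set.encard_le_encard (hsupp n)).trans_eq (by
      rw [← Finset.coe_range, Set.encard_coe_eq_coe_finsetCard, Finset.card_range])
  have hfav_mono (n : ℕ) :
      favourable M ε P I (k n) (m n) n ⊆ favourable M ε P I n₀ (m n) n :=
    fun x hx => ⟨hcard n, hx.2⟩
  -- `δ` is split into thirds for `α`, the average regret and the thresholds; the last third is `4`
  -- times `δ / 12`.
  set α : ℝ := min (δ / 3) 1 with hαdef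
  have hα0 : 0 < α := lt_min (by positivity) one_pos
  have hα : α ∈ Set.Icc (0 : ℝ) 1 := ⟨hα0.le, min_le_right _ _⟩
  let W (n j : ℕ) : Set (ℕ → Z) := {x | m n ≤ numUpdates M ε j n x ∧
    δ / 3 < subRegret M ε loss H A j n x / numUpdates M ε j n x}
  obtain ⟨s₀, hs₀⟩ : ∃ s₀ : ℕ, ∀ s ≥ s₀, (s : ℝ)⁻¹ * ∑ i ∈ Finset.range s, ε i ≤ δ / 12 :=
    eventually_atTop.1 (hε_lim.cesaro.eventually_le_const (by positivity))
  have hsub : ∀ᶠ n in atTop,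
      {x | risk P loss (output M ε A I n x) n x - minRisk P loss H n x > δ} ⊆
        excessEvent loss H A M ε I P α n ∪ ((favourable M ε P I (k n) (m n) n)ᶜ ∪
          ({x | I n (hist n x) ∉ activeSupport P I n} ∪ ⋃ j ∈ Finset.range n₀, W n j)) := by
    filter_upwards [hm.eventually_ge_atTop s₀] with n hn x hx
    by_contra hnot
    simp only [Set.mem_union, not_or, Set.mem_compl_iff, not_not, Set.mem_iUnion,
      not_exists] at hnot
    obtain ⟨h1, h2, h3, h4⟩ := hnot
    have h3 : I n (hist n x) ∈ activeSupport P I n := not_not.1 h3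
    have hms := h2.2 _ h3
    have h4 := h4 _ (Finset.mem_range.2 (hsupp n h3))
    have h4 : subRegret M ε loss H A (I n (hist n x)) n x /
        numUpdates M ε (I n (hist n x)) n x ≤ δ / 3 := not_lt.1 fun h => h4 ⟨hms, h⟩
    rw [excessEvent, Set.mem_ofPred_eq, gt_iff_lt, not_lt] at h1
    have h5 := hs₀ _ (hn.trans hms)
    have h6 := sum_updates_le (M := M) hε (I n (hist n x)) n x
    have h7 : 4 / (numUpdates M ε (I n (hist n x)) n x : ℝ) *
        ∑ t ∈ updates M ε (I n (hist n x)) n x, ε t ≤ δ / 3 := by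
      calc _ ≤ 4 / (numUpdates M ε (I n (hist n x)) n x : ℝ) *
            ∑ i ∈ Finset.range (numUpdates M ε (I n (hist n x)) n x), ε i := by gcongr
        _ = 4 * ((numUpdates M ε (I n (hist n x)) n x : ℝ)⁻¹ *
            ∑ i ∈ Finset.range (numUpdates M ε (I n (hist n x)) n x), ε i) := by ring
        _ ≤ δ / 3 := by linarith
    have h8 : α ≤ δ / 3 := min_le_left _ _
    have hx : δ < risk P loss (output M ε A I n x) n x - minRisk P loss H n x := hx
    linarith
  have hexp : Tendsto (fun n => (n₀ : ℝ≥0∞) *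
      ENNReal.ofReal (Real.exp (-(m n * α ^ 2 / 2 - 2)))) atTop (𝓝 0) := by
    have hmR : Tendsto (fun n => (m n : ℝ)) atTop atTop := tendsto_natCast_atTop_iff.2 hm
    have h1 : Tendsto (fun n => (m n : ℝ) * α ^ 2 / 2 - 2) atTop atTop :=
      tendsto_atTop_add_const_right _ _
        ((hmR.atTop_mul_const (by positivity)).atTop_div_const two_pos)
    have h2 := ENNReal.tendsto_ofReal (Real.tendsto_exp_neg_atTop_nhds_zero.comp h1)
    rw [ENNReal.ofReal_zero] at h2
    simpa using ENNReal.Tendsto.const_mul h2 (Or.inr (ENNReal.natCast_ne_top n₀))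
  have hW : Tendsto (fun n => ∑ j ∈ Finset.range n₀, P.law (W n j)) atTop (𝓝 0) := by
    simpa using tendsto_finsetSum (Finset.range n₀) fun j _ =>
      hl.tendsto_measure_subRegret (M := M) (ε := ε) hA hAm hM hP hH hm j
        (by positivity : 0 < δ / 3)
  have htot := ((hexp.add hfav).add (hfav.add hW))
  simp only [add_zero] at htot
  refine tendsto_of_tendsto_of_tendsto_of_le_of_le' tendsto_const_nhds htot
    (.of_forall fun _ => zero_le) ?_
  filter_upwards [hsub, hm.eventually_ge_atTop 1] with n hn hmn
  refine (measure_mono hn).trans ((measure_union_le _ _).trans (add_le_add ?_ ?_))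
  · exact (hl.measure_excessEvent_le hA hAm hM hε hε0 hI hP hα n n₀ hmn).trans
      (add_le_add le_rfl (measure_mono (Set.compl_subset_compl.2 (hfav_mono n))))
  · refine (measure_union_le _ _).trans (add_le_add le_rfl ((measure_union_le _ _).trans ?_))
    rw [measure_active_notMem_activeSupport, zero_add]
    exact measure_biUnion_finset_le _ _

end Learning

end CRM

theorem theorem4 {Z E : Type*} [MeasurableSpace Z]
    [AddCommGroup E] [Module ℝ E] [MeasurableSpace E] [MeasurableAdd₂ E] [MeasurableConstSMul ℝ E]
    -- the decision space `D` and the convex loss with values in `[0, 1]`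
    (D : Set E) (loss : E → Z → ℝ)
    (hloss_meas : Measurable (fun p : D × Z => loss p.1 p.2))
    (hloss_mem : ∀ d ∈ D, ∀ z, loss d z ∈ Set.Icc (0 : ℝ) 1)
    (hloss_convex : ∀ z, ConvexOn ℝ D (fun d => loss d z))
    -- the hypothesis class
    (H : Set (Z → E)) (hH : H.Nonempty)
    (hH_mem : ∀ h ∈ H, ∀ z, h z ∈ D) (hH_meas : ∀ h ∈ H, Measurable h)
    -- the online algorithm that is run in each subroutine
    (A : CRM.OnlineAlg Z E) (hA_mem : ∀ i y, A i y ∈ H)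
    (hA_meas : ∀ i, Measurable (fun p : (Fin i → Z) × Z => A i p.1 p.2))
    -- the computable bounds, the thresholds and the choice of the active subroutine
    (M : CRM.Bounds Z) (hM_meas : ∀ i j, Measurable (M i j))
    (ε : ℕ → ℝ) (hε_anti : Antitone ε) (hε_lim : Tendsto ε atTop (𝓝 0))
    (I : (n : ℕ) → (Fin n → Z) → ℕ) (hI : CRM.IsActiveRule M ε I) :
    -- the risk bound
    (∀ P : CRM.StochProc Z, CRM.Admissible M loss H P →
      ∀ n k m : ℕ, 1 ≤ k → 1 ≤ m → ∀ α ∈ Set.Icc (0 : ℝ) 1, ∀ β ∈ Set.Icc (0 : ℝ) (α / 8),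
        P.law {x | CRM.risk P loss (CRM.output M ε A I n x) n x - CRM.minRisk P loss H n x >
            α + CRM.subRegret M ε loss H A (I n (CRM.hist n x)) n x
                / CRM.numUpdates M ε (I n (CRM.hist n x)) n x
              + 4 / CRM.numUpdates M ε (I n (CRM.hist n x)) n x
                * ∑ t ∈ CRM.updates M ε (I n (CRM.hist n x)) n x, ε t}
          ≤ 4 * (k : ℝ≥0∞) * (CRM.seqCoveringNumber (CRM.lossClass loss H) β n : ℝ≥0∞)
                / ENNReal.ofReal ((α / 2 - 4 * β) ^ 2)
                * ENNReal.ofReal (Real.exp (-(1 / 2) * m * (α / 2 - 4 * β) ^ 2))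
              + P.law (CRM.favourable M ε P I k m n)ᶜ) ∧
    -- learnability
    (CRM.HannanConsistent loss H A →
      ∀ C : Set (CRM.StochProc Z),
        (∀ P ∈ C, CRM.Admissible M loss H P ∧ ∃ k m : ℕ → ℕ,
          Tendsto (fun n => (m n : ℝ) / Real.log n) atTop atTop ∧
          Tendsto (fun n => P.law (CRM.favourable M ε P I (k n) (m n) n)ᶜ) atTop (𝓝 0)) →
        (∀ δ > 0, CRM.IsEpsLearner loss H (CRM.output M ε A I) C δ) ∧
        (Convex ℝ H → CRM.IsLimitLearner loss H (CRM.output M ε A I) C)) := by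
  have hl : CRM.IsBoundedConvexLoss D loss H :=
    ⟨hloss_meas, hloss_mem, hloss_convex, hH, hH_mem, hH_meas⟩
  have hε0 : ∀ t, 0 ≤ ε t := fun t => hε_anti.le_of_tendsto hε_lim t
  refine ⟨fun P hP n k m _ hm α hα β hβ => ?_, fun hHannan C hC => ?_⟩
  · obtain ⟨x₀⟩ : Nonempty (ℕ → Z) := nonempty_of_isProbabilityMeasure P.law
    have : Nonempty Z := ⟨x₀ 0⟩
    have hN : (1 : ℝ≥0∞) ≤ (CRM.seqCoveringNumber (CRM.lossClass loss H) β n : ℝ≥0∞) := by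
      exact_mod_cast CRM.one_le_seqCoveringNumber (hH.image _) β n
    exact (hl.measure_excessEvent_le hA_mem hA_meas hM_meas hε_anti hε0 hI hP hα n k hm).trans
      (add_le_add (CRM.exp_bound_le hα hβ k m hN) le_rfl)
  · have hlim (P : CRM.StochProc Z) (hPC : P ∈ C) (δ : ℝ) (hδ : 0 < δ) :
        Tendsto (fun n => P.law {x | CRM.risk P loss (CRM.output M ε A I n x) n x
          - CRM.minRisk P loss H n x > δ}) atTop (𝓝 0) := by
      obtain ⟨hP, k, m, hm, hfav⟩ := hC P hPC
      exact hl.tendsto_measure_excess_risk hA_mem hA_meas hM_meas hε_anti hε_lim hI hP hHannan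
        (CRM.tendsto_atTop_of_div_log hm) hfav hδ
    refine ⟨fun δ hδ => ⟨CRM.dependsOn_output A I, fun P hPC => hlim P hPC δ hδ⟩,
      fun hconv => ⟨CRM.output_mem I hA_mem hconv, CRM.dependsOn_output A I, fun P hPC => ?_⟩⟩
    rw [tendstoInMeasure_iff_dist]
    intro δ hδ
    -- Convergence in measure uses `δ ≤ dist`, hence the passage to `δ / 2`. Convexity puts the
    -- output in `H`, so the excess risk is nonnegative and equals its distance to `0`.
    refine tendsto_of_tendsto_of_tendsto_of_le_of_le tendsto_const_nhds
      (hlim P hPC (δ / 2) (half_pos hδ)) (fun _ => zero_le) fun n => measure_mono fun x hx => ?_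
    have hnonneg : CRM.minRisk P loss H n x ≤ CRM.risk P loss (CRM.output M ε A I n x) n x :=
      ciInf_le (hl.bddBelow_risk P n x) ⟨_, CRM.output_mem I hA_mem hconv n x⟩
    have hx : δ ≤ dist (CRM.risk P loss (CRM.output M ε A I n x) n x
        - CRM.minRisk P loss H n x) 0 := hx
    rw [Real.dist_eq, sub_zero, abs_of_nonneg (sub_nonneg.2 hnonneg)] at hx
    exact (half_lt_self hδ).trans_le hx
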